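/- **Model.** Fix real numbers $k\ge 2$, $\psi\ge 1$, $\upsilon\ge 1$ and positive constants $W_1$, $M_1$, $d_1$, $N_0$ (noise power), and $I_0\ge 0$. For each $n$ consider a hexagonal mesh network with tiers $l=1,\dots,L=L(n)$, where $L=\Theta(n^{1/k})$ and $L^k\le n$ (every tier contains a node). Tier $l$ has $n_l=\lfloor n/l^k\rfloor$ nodes, one in each of $n_l$ regular hexagonal cells (a central cell, complete rings around it and possibly part of the next ring) with distance $d_l=d_1l^{k/2}$ between neighbouring cell centres; it has bandwidth $W_l=W_1l^{\psi}$ and $M_l=M_1l^{\upsilon}$ antennas per node. It has path-loss exponent $\alpha_l>0$, antenna constant $C_l>0$, a received-power threshold $P_l^0$ bounded below by a positive constant independent of $l$, and the minimal transmit power $P_l=P_l^0d_l^{\alpha_l}/C_l$. With power gain $g$ the transmission range is $r_l(g)=(C_lP_lg/P_l^0)^{1/\alpha_l}$. *Traffic.* There are $n$ flows, with random destinations. Put $D_l=(1+1/l)^{k/2}$. A flow that reaches tier $l<L$ is finished there if its two end nodes at this tier are at most $D_l$ hops apart, and is passed on to tier $l+1$ otherwise; every flow that reaches tier $L$ is finished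 there. If $p_l(x)$ is the probability that a random ordered pair of distinct tier-$l$ nodes is $x$ hops apart, then a flow reaches tier $l$ with probability $Q_l=\prod_{i<l}(1-\xi_i)$, $\xi_i=\sum_{1\le x\le D_i}p_i(x)$. A flow that is passed on uses on average $H^u_l=2\,\mathbb E|X_{l+1}|/r_l(g)$ hops of tier $l$, where $X_{l+1}$ is uniform in a tier-$(l+1)$ cell centred at $0$; a flow finished at tier $l$ over $x$ cells uses $x\,d_l/r_l(g)$ hops. The load per tier-$l$ node is $$Z_l(g)=\frac{n}{n_l}\Big(Q_{l+1}H_l^u+Q_l\sum_{1\le x\le D_l}p_l(x)\,\frac{x\,d_l}{r_l(g)}\Big),$$ where for $l=L$ the first term is absent and the sum is over all $x\ge1$. *Rates.* Each cell is active in one of $1+\Delta c$ time slots ($\Delta c$ a constant); distinct cells at most two hops apart use different slots. Under **spatial multiplexing** (SM) the tiers use orthogonal bands; a link between antenna numbers $N_t,N_r$ has rate $\min\{N_t,N_r\}W_l\log_2(1+\mathrm{SINR})$, where interference comes from one node in each other cell of tier $l$ active in the same slot and a signal sent over distance $x$ is received with power $C_lP_lx^{-\alpha_l}$; $R_l^{(L)}$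 is the infimum of the rates of all same-tier, upstream and downstream links of tier $l$ inside a cell or between neighbouring cells, over all positions of the nodes in their cells; and $g=1$. Under **beamforming** (BF) interference is bounded by the constant $I_0$, $R_l^{(L)}=W_l\log_2\big(1+C_lM_l^2P_ld_l^{-\alpha_l}/(N_0+I_0)\big)$, and $g=M_l^2$. In both cases $R_l(n)=R_l^{(L)}/\big((1+\Delta c)Z_l(g)\big)\in(0,\infty]$ (with value $\infty$ if $Z_l(g)=0$) is the end-to-end rate of tier $l$, and the per-node throughput is $R(n)=\min_{1\le l\le L}R_l(n)$. **Theorem (scalability conditions).** 1. (SM) Suppose that $2<a\le\alpha_l\le b$ for all $l$, with constants $a,b$. If $\psi+\upsilon\ge k$, then $R_l^{(SM)}(n)=\Omega(1)$ uniformly in $1\le l\le L(n)$, and $R^{(SM)}(n)=\Theta(1)$ as $n\to\infty$. 2. (BF) Suppose that $\alpha_l=\alpha$ for all $l$. If $\psi+2\upsilon/\alpha\ge k$, then $R_l^{(BF)}(n)=\Omega(1)$ uniformly in $1\le l\le L(n)$, and $R^{(BF)}(n)=\Theta(1)$. If moreover $P^0_1\le P^0_l$ for all $l$ (in particular if the thresholds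 are equal), then for all sufficiently large $n$ the minimum is attained at tier 1: $R^{(BF)}(n)=R_1^{(BF)}(n)$. -/

import Mathlib

open Filter MeasureTheory
open scoped ENNReal

noncomputable section

namespace Mesh

/-! ### Hexagonal cells

A cell is given by its axial coordinates `(x, y)`; when neighbouring cells have centres at distance
`d`, its centre is the point `d * (x + y * ω)` of the plane, with `ω = exp (iπ/3)`. -/

/-- A hexagonal cell, in axial coordinates. -/
abbrev Cell : Type := ℤ × ℤ

/-- The number of hops between two cells (one hop leads to one of the six neighbouring cells). -/
def hopDist (u v : Cell) : ℕ :=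
  max (u.1 - v.1).natAbs (max (u.2 - v.2).natAbs ((u.1 - v.1) + (u.2 - v.2)).natAbs)

/-- The centre of a cell, when neighbouring centres are at distance `d`. -/
def center (d : ℝ) (u : Cell) : ℂ :=
  ⟨d * (u.1 + u.2 / 2), d * (Real.sqrt 3 / 2 * u.2)⟩

/-- The (closed, regular hexagonal) region of a cell: the points of the plane for which no centre
is nearer than the centre of that cell. -/
def region (d : ℝ) (u : Cell) : Set ℂ :=
  {z | ∀ w : Cell, ‖z - center d u‖ ≤ ‖z - center d w‖}

/-- The cells at most `m` hops away from the central cell; there are `3 m (m + 1) + 1` of them. -/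
def hexBall (m : ℕ) : Set Cell := {u | hopDist 0 u ≤ m}

/-- A hexagonal mesh network: the central cell, complete outer rings `1, …, m`, and possibly a part
of the outer ring `m + 1`. -/
def IsHexNetwork (V : Finset Cell) : Prop :=
  ∃ m : ℕ, hexBall m ⊆ ↑V ∧ (↑V : Set Cell) ⊆ hexBall (m + 1)

/-- The probability that a random source and a random other node of the network `V`, serving as its
destination, are `x` hops apart: the average over `i ∈ V` of `b_i(x) / (|V| - 1)`, where `b_i(x)` is
the number of nodes that are `x` hops away from `i`. -/
def hopProb (V : Finset Cell) (x : ℕ) : ℝ :=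
  (∑ i ∈ V, ((V.filter fun j => hopDist i j = x).card : ℝ) / ((V.card : ℝ) - 1)) / (V.card : ℝ)

/-- The hop counts that occur between distinct nodes of `V`. -/
def hopCounts (V : Finset Cell) : Finset ℕ :=
  V.offDiag.image fun p => hopDist p.1 p.2

end Mesh

open Mesh in
/-- A family of multi-tier mesh networks, one for every number `n` of data nodes. Tiers are indexed
by `l = 1, …, L n` (values at `l = 0` are never used). -/
structure MeshFamily where
  /-- scaling orders: node number `n / l ^ k`, bandwidth `W₁ l ^ ψ`, antenna number `M₁ l ^ υ` -/
  k : ℝ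
  ψ : ℝ
  υ : ℝ
  /-- bandwidth and antenna number of a data node (first tier) -/
  W₁ : ℝ
  M₁ : ℝ
  /-- distance between neighbouring cell centres of the first tier -/
  d₁ : ℝ
  /-- noise power -/
  N₀ : ℝ
  /-- bound on the interference power that is left when thin beams are used -/
  I₀ : ℝ
  /-- path-loss exponents, antenna constants and received-power thresholds of the tiers -/
  α : ℕ → ℝ
  C : ℕ → ℝ
  P₀ : ℕ → ℝ
  /-- number of tiers, and the cells of every tier -/
  L : ℕ → ℕ
  V : ℕ → ℕ → Finset Cell
  /-- time division with `Δc + 1` slots; `slot l u` is the slot in which cell `u` of tier `l` is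
  active -/
  Δc : ℕ
  slot : ℕ → Cell → Fin (Δc + 1)
  two_le_k : 2 ≤ k
  one_le_ψ : 1 ≤ ψ
  one_le_υ : 1 ≤ υ
  W₁_pos : 0 < W₁
  M₁_pos : 0 < M₁
  d₁_pos : 0 < d₁
  N₀_pos : 0 < N₀
  I₀_nonneg : 0 ≤ I₀
  α_pos : ∀ l, 1 ≤ l → 0 < α l
  C_pos : ∀ l, 1 ≤ l → 0 < C l
  P₀_bdd : ∃ p : ℝ, 0 < p ∧ ∀ l, 1 ≤ l → p ≤ P₀ l
  /-- the number of tiers is of the order of the `k`-th root of `n` … -/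
  L_theta : (fun n => (L n : ℝ)) =Θ[atTop] fun n => (n : ℝ) ^ (1 / k)
  /-- … and the highest tier still contains a node: `n / (L n) ^ k ≥ 1` -/
  L_le : ∀ n, (L n : ℝ) ^ k ≤ n
  V_hex : ∀ n l, 1 ≤ l → l ≤ L n → IsHexNetwork (V n l)
  V_card : ∀ n l, 1 ≤ l → l ≤ L n → (V n l).card = ⌊(n : ℝ) / (l : ℝ) ^ k⌋₊
  /-- a cell next to a receiving cell is silent, unless it is the transmitting cell -/
  slot_ne : ∀ l u v, u ≠ v → hopDist u v ≤ 2 → slot l u ≠ slot l v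

namespace MeshFamily

open Mesh

variable (N : MeshFamily)

/-- Bandwidth of tier `l`. -/
def W (l : ℕ) : ℝ := N.W₁ * (l : ℝ) ^ N.ψ

/-- Antenna number at tier `l`. -/
def M (l : ℕ) : ℝ := N.M₁ * (l : ℝ) ^ N.υ

/-- Distance between neighbouring cell centres of tier `l`; the cell area is proportional
to `l ^ k`. -/
def d (l : ℕ) : ℝ := N.d₁ * (l : ℝ) ^ (N.k / 2)

/-- Transmit power of an antenna element at tier `l`: the least power for which the received signal
power at distance `d l` reaches the threshold, i.e. `C P d ^ (-α) = P₀`. -/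
def P (l : ℕ) : ℝ := N.P₀ l * N.d l ^ N.α l / N.C l

/-- Transmission range of tier `l` when MIMO provides the power gain `g`, i.e. the solution `r` of
`C P g r ^ (-α) = P₀`. -/
def range (l : ℕ) (g : ℝ) : ℝ := (N.C l * N.P l * g / N.P₀ l) ^ (1 / N.α l)

/-! ### The `D`-hop maximum routing policy -/

/-- The maximum hop number of the routing policy at tier `l`. -/
def D (l : ℕ) : ℝ := (1 + 1 / (l : ℝ)) ^ (N.k / 2)

/-- The hop counts for which a flow is finished at tier `l`: those up to `D l`, and all of them at
the highest tier. -/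
def served (n l : ℕ) : Finset ℕ :=
  (hopCounts (N.V n l)).filter fun x => l = N.L n ∨ (x : ℝ) ≤ N.D l

/-- The probability that a flow that reaches tier `l` is finished there. -/
def ξ (n l : ℕ) : ℝ := ∑ x ∈ N.served n l, hopProb (N.V n l) x

/-- The probability that a flow reaches tier `l`: `Q 1 = 1` and `Q (l + 1) = (1 - ξ l) * Q l`. -/
def Q (n l : ℕ) : ℝ := ∏ i ∈ Finset.Ico 1 l, (1 - N.ξ n i)

/-- Expected number of tier-`l` hops of a flow that is passed on to tier `l + 1`. A tier-`l` node is
uniformly placed in the cell of its nearest tier-`(l + 1)` node, whose distance is covered in hops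
of length `range l g`, once on the source side (upstream) and once on the destination side
(downstream). -/
def upHops (l : ℕ) (g : ℝ) : ℝ :=
  2 * (⨍ z in region (N.d (l + 1)) 0, ‖z‖) / N.range l g

/-- Expected number of same-tier hops of a flow that reaches tier `l` (counted as `0` when the flow
is passed on to tier `l + 1`): `x` cells are crossed in hops of length `range l g`. -/
def sameHops (n l : ℕ) (g : ℝ) : ℝ :=
  ∑ x ∈ N.served n l, hopProb (N.V n l) x * (x * N.d l / N.range l g)

/-- Expected number of flows that a tier-`l` node serves: the total expected number of tier-`l` hops
of the `n` flows, divided by the number of tier-`l` nodes. -/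
def load (n l : ℕ) (g : ℝ) : ℝ :=
  n * ((if l < N.L n then N.Q n (l + 1) * N.upHops l g else 0) + N.Q n l * N.sameHops n l g)
    / ((N.V n l).card : ℝ)

/-! ### Link rates -/

/-- SINR at tier `l` of a transmission from a point `x` in cell `u` to a point `y`, when the tiers
use orthogonal frequency bands and every other cell `w` that is active in the slot of `u` contains
a transmitter, at the point `z w`. -/
def sinrSM (n l : ℕ) (u : Cell) (x y : ℂ) (z : Cell → ℂ) : ℝ :=
  N.C l * N.P l * ‖x - y‖ ^ (-N.α l) /
    (N.N₀ + ∑ w ∈ (N.V n l).filter (fun w => w ≠ u ∧ N.slot l w = N.slot l u),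
      N.C l * N.P l * ‖z w - y‖ ^ (-N.α l))

/-- Spatial multiplexing: the rates of all possible links of tier `l`, within a cell or between
neighbouring cells, wherever the nodes are in their cells. The pair `(Nt, Nr)` of antenna numbers
distinguishes same-tier, upstream and downstream transmission; the gain is `min Nt Nr`. -/
def linkRatesSM (n l : ℕ) : Set ℝ :=
  {r | ∃ (Nt Nr : ℝ) (u v : Cell) (x y : ℂ) (z : Cell → ℂ),
    ((Nt = N.M l ∧ Nr = N.M l) ∨ (Nt = N.M l ∧ Nr = N.M (l + 1)) ∨
      (Nt = N.M (l + 1) ∧ Nr = N.M l)) ∧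
    u ∈ N.V n l ∧ v ∈ N.V n l ∧ hopDist u v ≤ 1 ∧
    x ∈ region (N.d l) u ∧ y ∈ region (N.d l) v ∧ x ≠ y ∧ (∀ w, z w ∈ region (N.d l) w) ∧
    r = min Nt Nr * (N.W l * Real.logb 2 (1 + N.sinrSM n l u x y z))}

/-- Spatial multiplexing: the (greatest) lower bound on the link rates of tier `l`. -/
def linkRateSM (n l : ℕ) : ℝ := sInf (N.linkRatesSM n l)

/-- Beamforming: the lower bound on the SINR at tier `l`, with power gain `M l ^ 2`. -/
def sinrBF (l : ℕ) : ℝ :=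
  N.C l * N.M l ^ 2 * N.P l * N.d l ^ (-N.α l) / (N.N₀ + N.I₀)

/-- Beamforming: the lower bound on the link rates of tier `l` (a single data stream). -/
def linkRateBF (l : ℕ) : ℝ := N.W l * Real.logb 2 (1 + N.sinrBF l)

/-! ### End-to-end rates and throughput

Rates take values in `[0, ∞]`; a tier that carries no traffic has the rate `∞`. -/

/-- The end-to-end rate of a tier with link rate `R`, whose nodes share their links among `Z` flows
and are active in one of `1 + Δc` slots. -/
def endRate (R Z : ℝ) : ℝ≥0∞ :=
  ENNReal.ofReal R / ENNReal.ofReal ((1 + (N.Δc : ℝ)) * Z)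

/-- End-to-end rate of tier `l` under spatial multiplexing (no range extension). -/
def rateSM (n l : ℕ) : ℝ≥0∞ := N.endRate (N.linkRateSM n l) (N.load n l 1)

/-- End-to-end rate of tier `l` under beamforming. -/
def rateBF (n l : ℕ) : ℝ≥0∞ := N.endRate (N.linkRateBF l) (N.load n l (N.M l ^ 2))

/-- The per-node throughput: the minimum of the end-to-end rates of the tiers `1, …, L n`. -/
def throughput (rate : ℕ → ℕ → ℝ≥0∞) (n : ℕ) : ℝ≥0∞ :=
  (Finset.Icc 1 (N.L n)).inf (rate n)

/-- The end-to-end rates of all tiers `1, …, L n` are `Ω(1)`, with a common constant. -/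
def AllTiersOmegaOne (rate : ℕ → ℕ → ℝ≥0∞) : Prop :=
  ∃ c : ℝ, 0 < c ∧ ∀ᶠ n in atTop, ∀ l, 1 ≤ l → l ≤ N.L n → ENNReal.ofReal c ≤ rate n l

end MeshFamily

/-- `f = Θ(1)` as `n → ∞`, for a `[0, ∞]`-valued `f`. -/
def IsThetaOne (f : ℕ → ℝ≥0∞) : Prop :=
  ∃ c c' : ℝ, 0 < c ∧ ∀ᶠ n in atTop, ENNReal.ofReal c ≤ f n ∧ f n ≤ ENNReal.ofReal c'

end

open Topology

/-! ### The hop metric on cells -/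

namespace Mesh

/-! The load factors as `n / n_l` times a mean hop number `hops` divided by the range extension `g ^
(1 / α)` (`load_eq`). Rounding down costs at most a factor 2, so `n / n_l ≤ 2 l ^ k`. The hop number
is bounded uniformly in `l`: passing a flow on costs `2 * meanDist * D l` hops, because cells are
similar and `d (l + 1) / d l = D l ≤ D 1`; finishing it costs at most `D l` cells below the top
tier, and a bounded number at the top, where only boundedly many nodes are left. Hence a tier has
rate `Ω(1)` as soon as link rate times range extension is at least a constant times `l ^ k`
(`allTiersOmegaOne_endRate`).

For SM the SINR is bounded below independently of `l` (`le_sinrSM`): the transmit power makes signal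
and interference scale-free, and the interference is dominated by a lattice sum that converges for
exponents above 2. Link rates are then at least of order `M l * W l`, that is `l ^ (ψ + υ)`. For BF
the link rate is at least of order `l ^ ψ` and the range extension is of order `l ^ (2υ / α)`. For
the upper bound the first tier suffices: it has `n` nodes, a bounded link rate and a hop number
bounded away from 0.

That tier 1 attains the BF minimum requires the sharp inequality `(n / n_l) * hops l ≤ l ^ k * hops
1`, where the factor 2 is not affordable. If `n / l ^ k` is large, rounding and the finished flows
are negligible, and the strict gap `D 2 < D 1` leaves room. If `n / l ^ k` is bounded, a number of
lower tiers of order `n ^ (1 / k)` have each finished a fixed proportion of the flows, so `Q l`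
tends to 0 (`eventually_Q_le`) and absorbs every constant. -/

theorem hopDist_self (u : Cell) : hopDist u u = 0 := by simp [hopDist]

theorem hopDist_comm (u v : Cell) : hopDist u v = hopDist v u := by
  unfold hopDist; omega

theorem hopDist_triangle (u v w : Cell) : hopDist u w ≤ hopDist u v + hopDist v w := by
  have h (x y : ℤ) : (x + y).natAbs ≤ x.natAbs + y.natAbs := Int.natAbs_add_le x y
  unfold hopDist
  refine max_le ?_ (max_le ?_ ?_)
  · have := h (u.1 - v.1) (v.1 - w.1)
    rw [sub_add_sub_cancel] at this
    exact this.trans (add_le_add (le_max_left _ _) (le_max_left _ _))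
  · have := h (u.2 - v.2) (v.2 - w.2)
    rw [sub_add_sub_cancel] at this
    exact this.trans (add_le_add ((le_max_left _ _).trans (le_max_right _ _))
      ((le_max_left _ _).trans (le_max_right _ _)))
  · have := h ((u.1 - v.1) + (u.2 - v.2)) ((v.1 - w.1) + (v.2 - w.2))
    rw [add_add_add_comm, sub_add_sub_cancel, sub_add_sub_cancel] at this
    exact this.trans (add_le_add ((le_max_right _ _).trans (le_max_right _ _))
      ((le_max_right _ _).trans (le_max_right _ _)))

theorem eq_of_hopDist_eq_zero {u v : Cell} (h : hopDist u v = 0) : u = v := by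
  unfold hopDist at h
  ext <;> omega

/-- A cell other than the central one has a neighbour that is one hop nearer to the centre. -/
theorem exists_neighbour_toward_zero {u : Cell} (hu : u ≠ 0) :
    ∃ v, hopDist u v = 1 ∧ hopDist 0 v + 1 = hopDist 0 u := by
  obtain ⟨x, y⟩ := u
  have hxy : x ≠ 0 ∨ y ≠ 0 := by
    by_contra! h
    exact hu (by simp [h.1, h.2])
  rcases lt_trichotomy x 0 with hx | hx | hx <;> rcases lt_trichotomy y 0 with hy | hy | hy
  · exact ⟨(x + 1, y), by simp only [hopDist, Prod.fst_zero, Prod.snd_zero]; omega⟩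
  · exact ⟨(x + 1, y), by simp only [hopDist, Prod.fst_zero, Prod.snd_zero]; omega⟩
  · exact ⟨(x + 1, y - 1), by simp only [hopDist, Prod.fst_zero, Prod.snd_zero]; omega⟩
  · exact ⟨(x, y + 1), by simp only [hopDist, Prod.fst_zero, Prod.snd_zero]; omega⟩
  · omega
  · exact ⟨(x, y - 1), by simp only [hopDist, Prod.fst_zero, Prod.snd_zero]; omega⟩
  · exact ⟨(x - 1, y + 1), by simp only [hopDist, Prod.fst_zero, Prod.snd_zero]; omega⟩
  · exact ⟨(x - 1, y), by simp only [hopDist, Prod.fst_zero, Prod.snd_zero]; omega⟩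
  · exact ⟨(x - 1, y), by simp only [hopDist, Prod.fst_zero, Prod.snd_zero]; omega⟩

/-! ### Hexagonal networks -/

theorem IsHexNetwork.zero_mem {V : Finset Cell} (h : IsHexNetwork V) : (0 : Cell) ∈ V := by
  obtain ⟨m, hm, -⟩ := h
  exact hm (by simp [hexBall, hopDist_self])

/-- A step towards the centre lands in a complete ring, hence in the network. The centre itself has
`(1, 0)` as a neighbour if `m ≥ 1`; if `m = 0`, every other cell is adjacent to it. -/
theorem IsHexNetwork.exists_neighbour {V : Finset Cell} (h : IsHexNetwork V) (hV : 2 ≤ V.card)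
    {u : Cell} (hu : u ∈ V) : ∃ v ∈ V, hopDist u v = 1 := by
  have h0 := h.zero_mem
  obtain ⟨m, hm, hm'⟩ := h
  have key : ∀ w ∈ V, w ≠ 0 → ∃ v ∈ V, hopDist w v = 1 ∧ hopDist 0 v + 1 = hopDist 0 w := by
    intro w hw hw0
    obtain ⟨v, hv1, hv2⟩ := exists_neighbour_toward_zero hw0
    have : hopDist 0 w ≤ m + 1 := hm' hw
    exact ⟨v, hm (show hopDist 0 v ≤ m by omega), hv1, hv2⟩
  by_cases hu0 : u = 0
  · subst hu0
    obtain ⟨w, hw, hw0⟩ := Finset.exists_mem_ne (by omega : 1 < V.card) (0 : Cell)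
    rcases Nat.eq_zero_or_pos m with hm0 | hm0
    · refine ⟨w, hw, ?_⟩
      have h1 : hopDist 0 w ≤ m + 1 := hm' hw
      have h2 : hopDist 0 w ≠ 0 := fun h => hw0 (eq_of_hopDist_eq_zero h).symm
      omega
    · exact ⟨(1, 0), hm (by simp [hexBall, hopDist]; omega), by simp [hopDist]⟩
  · obtain ⟨v, hv, hv1, -⟩ := key u hu hu0
    exact ⟨v, hv, hv1⟩

/-- A straight ray of `m + 1` cells lies in the complete rings. The bound is crude, but it is needed
only at the top tier, where the node number is bounded. -/
theorem IsHexNetwork.hopDist_le {V : Finset Cell} (h : IsHexNetwork V) {u v : Cell} (hu : u ∈ V)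
    (hv : v ∈ V) : hopDist u v ≤ 2 * V.card := by
  obtain ⟨m, hm, hm'⟩ := h
  have hu' : hopDist 0 u ≤ m + 1 := hm' hu
  have hv' : hopDist 0 v ≤ m + 1 := hm' hv
  have hcard : m + 1 ≤ V.card := by
    have : ((Finset.range (m + 1)).image fun i : ℕ => ((i : ℤ), (0 : ℤ))) ⊆ V := by
      intro w hw
      obtain ⟨i, hi, rfl⟩ := Finset.mem_image.1 hw
      refine hm ?_
      have := Finset.mem_range.1 hi
      simp only [hexBall, hopDist, Set.mem_ofPred_eq, Prod.fst_zero, Prod.snd_zero]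
      omega
    have h2 := Finset.card_le_card this
    rwa [Finset.card_image_of_injective _ (fun i j hij => by simpa using hij),
      Finset.card_range] at h2
  have := hopDist_triangle u 0 v
  rw [hopDist_comm u 0] at this
  omega

theorem pos_of_mem_hopCounts {V : Finset Cell} {x : ℕ} (h : x ∈ hopCounts V) : 1 ≤ x := by
  simp only [hopCounts, Finset.mem_image, Finset.mem_offDiag] at h
  obtain ⟨⟨u, v⟩, ⟨-, -, huv⟩, rfl⟩ := h
  exact Nat.one_le_iff_ne_zero.2 fun h => huv (eq_of_hopDist_eq_zero h)

theorem IsHexNetwork.le_of_mem_hopCounts {V : Finset Cell} (h : IsHexNetwork V) {x : ℕ}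
    (hx : x ∈ hopCounts V) : x ≤ 2 * V.card := by
  simp only [hopCounts, Finset.mem_image, Finset.mem_offDiag] at hx
  obtain ⟨⟨u, v⟩, ⟨hu, hv, -⟩, rfl⟩ := hx
  exact h.hopDist_le hu hv

/-! ### Hop count probabilities -/

theorem hopProb_nonneg (V : Finset Cell) (x : ℕ) : 0 ≤ hopProb V x := by
  rcases V.eq_empty_or_nonempty with rfl | hV
  · simp [hopProb]
  · have : (1 : ℝ) ≤ V.card := by exact_mod_cast hV.card_pos
    unfold hopProb
    have : (0 : ℝ) ≤ V.card - 1 := by linarith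
    positivity

/-- Grouping the nodes `j` by their hop count from `i` turns sums of probabilities into node counts,
to be estimated for each `i` separately. -/
theorem sum_hopProb (V : Finset Cell) (S : Finset ℕ) :
    ∑ x ∈ S, hopProb V x =
      (∑ i ∈ V, ((V.filter fun j => hopDist i j ∈ S).card : ℝ) / ((V.card : ℝ) - 1)) /
        (V.card : ℝ) := by
  unfold hopProb
  rw [← Finset.sum_div, Finset.sum_comm]
  congr 1
  refine Finset.sum_congr rfl fun i _ => ?_
  rw [← Finset.sum_div]
  congr 1
  rw [Finset.card_eq_sum_card_fiberwise (s := V.filter fun j => hopDist i j ∈ S) (t := S)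
    (f := fun j => hopDist i j) (fun j hj => by simpa using (Finset.mem_filter.1 hj).2)]
  push_cast
  refine Finset.sum_congr rfl fun x hx => ?_
  congr 2
  ext j
  simp only [Finset.mem_filter]
  constructor
  · rintro ⟨h1, rfl⟩; exact ⟨⟨h1, hx⟩, rfl⟩
  · rintro ⟨⟨h1, -⟩, h2⟩; exact ⟨h1, h2⟩

theorem sum_hopProb_le {V : Finset Cell} {S : Finset ℕ} {B : ℝ} (hV : V.Nonempty)
    (h : ∀ i ∈ V, ((V.filter fun j => hopDist i j ∈ S).card : ℝ) ≤ B) :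
    ∑ x ∈ S, hopProb V x ≤ B / ((V.card : ℝ) - 1) := by
  rw [sum_hopProb]
  have h1 : (1 : ℝ) ≤ V.card := by exact_mod_cast hV.card_pos
  rw [div_le_iff₀ (by linarith), mul_comm (B / _), ← nsmul_eq_mul]
  refine Finset.sum_le_card_nsmul _ _ _ fun i hi => ?_
  have := h i hi
  have h2 : (0 : ℝ) ≤ V.card - 1 := by linarith
  gcongr

theorem le_sum_hopProb {V : Finset Cell} {S : Finset ℕ} {A : ℝ} (hV : V.Nonempty)
    (h : ∀ i ∈ V, A ≤ ((V.filter fun j => hopDist i j ∈ S).card : ℝ)) :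
    A / ((V.card : ℝ) - 1) ≤ ∑ x ∈ S, hopProb V x := by
  rw [sum_hopProb]
  have h1 : (1 : ℝ) ≤ V.card := by exact_mod_cast hV.card_pos
  rw [le_div_iff₀ (by linarith), mul_comm, ← nsmul_eq_mul]
  refine Finset.card_nsmul_le_sum _ _ _ fun i hi => ?_
  have := h i hi
  have h2 : (0 : ℝ) ≤ V.card - 1 := by linarith
  gcongr

theorem sum_hopProb_le_one {V : Finset Cell} {S : Finset ℕ} (hS : S ⊆ hopCounts V) :
    ∑ x ∈ S, hopProb V x ≤ 1 := by
  rcases V.eq_empty_or_nonempty with rfl | hV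
  · simp [hopProb]
  have h1 : (1 : ℝ) ≤ V.card := by exact_mod_cast hV.card_pos
  -- Hop count 0 does not occur in `S`, so `i` itself is not counted. For a single node the quotient
  -- is `0 / 0 = 0`.
  refine (sum_hopProb_le (B := (V.card : ℝ) - 1) hV fun i hi => ?_).trans
    (div_self_le_one _)
  have : (V.filter fun j => hopDist i j ∈ S) ⊆ V.erase i := by
    intro j hj
    obtain ⟨hj1, hj2⟩ := Finset.mem_filter.1 hj
    refine Finset.mem_erase.2 ⟨?_, hj1⟩
    rintro rfl
    have := pos_of_mem_hopCounts (hS hj2)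
    rw [hopDist_self] at this
    omega
  have := Finset.card_le_card this
  rw [Finset.card_erase_of_mem hi] at this
  have h3 : 1 ≤ V.card := hV.card_pos
  have : ((V.filter fun j => hopDist i j ∈ S).card : ℝ) ≤ ((V.card - 1 : ℕ) : ℝ) := by
    exact_mod_cast this
  rwa [Nat.cast_sub h3, Nat.cast_one] at this

theorem card_filter_hopDist_le (V : Finset Cell) (i : Cell) (B : ℕ) :
    (V.filter fun j => hopDist i j ≤ B).card ≤ (2 * B + 1) ^ 2 := by
  have : (V.filter fun j => hopDist i j ≤ B) ⊆
      Finset.Icc (i.1 - B) (i.1 + B) ×ˢ Finset.Icc (i.2 - B) (i.2 + B) := by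
    intro j hj
    have := (Finset.mem_filter.1 hj).2
    unfold hopDist at this
    simp only [Finset.mem_product, Finset.mem_Icc]
    omega
  refine (Finset.card_le_card this).trans (le_of_eq ?_)
  rw [Finset.card_product, Int.card_Icc, Int.card_Icc, sq]
  congr 1 <;> omega

/-! ### Geometry of cells -/

theorem normSq_center_sub (d : ℝ) (u v : Cell) :
    ‖center d u - center d v‖ ^ 2 = d ^ 2 * (((u.1 - v.1 : ℤ) : ℝ) ^ 2 +
      ((u.1 - v.1 : ℤ) : ℝ) * ((u.2 - v.2 : ℤ) : ℝ) + ((u.2 - v.2 : ℤ) : ℝ) ^ 2) := by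
  rw [← Complex.normSq_eq_norm_sq, Complex.normSq_apply]
  simp only [center, Complex.sub_re, Complex.sub_im]
  have h3 : Real.sqrt 3 ^ 2 = 3 := Real.sq_sqrt (by norm_num)
  push_cast
  linear_combination d ^ 2 * (u.2 - v.2) ^ 2 / 4 * h3

/-- The constant is just below `√3 / 2`: `4 (x² + xy + y²)` exceeds `3x²`, `3y²` and `3(x + y)²` by
the squares of `x + 2y`, `y + 2x` and `x - y`. -/
theorem le_norm_center_sub (d : ℝ) (u v : Cell) :
    0.86 * d * hopDist u v ≤ ‖center d u - center d v‖ := by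
  refine le_of_sq_le_sq ?_ (norm_nonneg _)
  rw [normSq_center_sub]
  generalize hx : u.1 - v.1 = x
  generalize hy : u.2 - v.2 = y
  have h : ((hopDist u v : ℕ) : ℝ) ^ 2 * 3 ≤ 4 * ((x : ℝ) ^ 2 + x * y + y ^ 2) := by
    have : hopDist u v = x.natAbs ∨ hopDist u v = y.natAbs ∨ hopDist u v = (x + y).natAbs := by
      unfold hopDist; omega
    have e : ∀ t : ℤ, ((t.natAbs : ℕ) : ℝ) ^ 2 = (t : ℝ) ^ 2 := by
      intro t
      rw [Nat.cast_natAbs]; push_cast; rw [sq_abs]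
    rcases this with h | h | h <;> rw [h, e] <;> push_cast <;>
      nlinarith [sq_nonneg ((x : ℝ) + 2 * y), sq_nonneg ((y : ℝ) + 2 * x), sq_nonneg ((x : ℝ) - y)]
  nlinarith [mul_le_mul_of_nonneg_left h (sq_nonneg d), sq_nonneg (d * hopDist u v)]

theorem norm_center_sub_le {d : ℝ} (hd : 0 ≤ d) {u v : Cell} (h : hopDist u v ≤ 1) :
    ‖center d u - center d v‖ ≤ d := by
  refine le_of_sq_le_sq ?_ hd
  rw [normSq_center_sub]
  generalize hx : u.1 - v.1 = x
  generalize hy : u.2 - v.2 = y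
  unfold hopDist at h
  rw [hx, hy] at h
  have : x ^ 2 + x * y + y ^ 2 ≤ 1 := by
    have h1 : -1 ≤ x := by omega
    have h2 : x ≤ 1 := by omega
    have h3 : -1 ≤ y := by omega
    have h4 : y ≤ 1 := by omega
    interval_cases x <;> interval_cases y <;> simp_all
  have : (x : ℝ) ^ 2 + x * y + y ^ 2 ≤ 1 := by exact_mod_cast this
  nlinarith [sq_nonneg d]

theorem norm_sub_center_le {d : ℝ} (hd : 0 < d) {u : Cell} {z : ℂ} (hz : z ∈ region d u) :
    ‖z - center d u‖ ≤ 0.6 * d := by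
  have h3 : Real.sqrt 3 ^ 2 = 3 := Real.sq_sqrt (by norm_num)
  have hs : 0 < Real.sqrt 3 := by positivity
  have key : ∀ e : Cell, ∀ p, p = z - center d u →
      p.re ^ 2 + p.im ^ 2 ≤ (p.re - d * (e.1 + e.2 / 2)) ^ 2 +
        (p.im - d * (Real.sqrt 3 / 2 * e.2)) ^ 2 := by
    rintro e p rfl
    have h := hz (u + e)
    have h := pow_le_pow_left₀ (norm_nonneg _) h 2
    rw [← Complex.normSq_eq_norm_sq, Complex.normSq_apply, ← Complex.normSq_eq_norm_sq,
      Complex.normSq_apply] at h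
    simp only [center, Complex.sub_re, Complex.sub_im, Prod.fst_add, Prod.snd_add,
      Int.cast_add] at h ⊢
    linear_combination h
  refine le_of_sq_le_sq ?_ (by positivity)
  rw [← Complex.normSq_eq_norm_sq, Complex.normSq_apply]
  generalize hp : z - center d u = p at key
  have k1 := key (1, 0) p rfl
  have k2 := key (-1, 0) p rfl
  have k3 := key (0, 1) p rfl
  have k4 := key (0, -1) p rfl
  have k5 := key (1, -1) p rfl
  have k6 := key (-1, 1) p rfl
  push_cast at k1 k2 k3 k4 k5 k6
  generalize p.re = a at *
  generalize hq : p.im = b at *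
  set s := Real.sqrt 3
  have l1 : 2 * a ≤ d := le_of_mul_le_mul_left (by nlinarith) hd
  have l2 : -(2 * a) ≤ d := le_of_mul_le_mul_left (by nlinarith) hd
  have l3 : a + s * b ≤ d := le_of_mul_le_mul_left (by nlinarith) hd
  have l4 : -a - s * b ≤ d := le_of_mul_le_mul_left (by nlinarith) hd
  have l5 : a - s * b ≤ d := le_of_mul_le_mul_left (by nlinarith) hd
  have l6 : -a + s * b ≤ d := le_of_mul_le_mul_left (by nlinarith) hd
  -- The six neighbours give `|a| ≤ d / 2` and `√3 |b| ≤ d - |a|`, whence `a² + b² ≤ d² / 3`, the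
  -- squared circumradius, which is below `(0.6 d)²`.
  have m1 : (s * b) ^ 2 ≤ (d - |a|) ^ 2 := by
    refine sq_le_sq' ?_ ?_ <;> cases abs_cases a <;> linarith
  have m2 : a ^ 2 = |a| ^ 2 := (sq_abs a).symm
  have m3 : 2 * |a| ≤ d := by cases abs_cases a <;> linarith
  have m4 : (s * b) ^ 2 = 3 * b ^ 2 := by rw [mul_pow, h3]
  nlinarith [mul_nonneg (abs_nonneg a) (sub_nonneg.2 m3), sq_nonneg d]

theorem closedBall_subset_region {d : ℝ} (hd : 0 < d) (u : Cell) :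
    Metric.closedBall (center d u) (d / 4) ⊆ region d u := by
  intro z hz w
  rw [Metric.mem_closedBall, dist_eq_norm] at hz
  rcases eq_or_ne u w with rfl | huw
  · exact le_rfl
  have h1 := le_norm_center_sub d w u
  have h2 : (1 : ℝ) ≤ hopDist w u := by
    exact_mod_cast Nat.one_le_iff_ne_zero.2 fun h => huw (eq_of_hopDist_eq_zero h).symm
  have h3 := norm_sub_le (z - center d u) (z - center d w)
  rw [sub_sub_sub_cancel_left] at h3
  nlinarith

/-! ### Dilation of cells and the mean distance from the centre -/

theorem isClosed_region (d : ℝ) (u : Cell) : IsClosed (region d u) := by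
  simp only [region, Set.ofPred_forall]
  exact isClosed_iInter fun w => isClosed_le (by fun_prop) (by fun_prop)

theorem center_zero (d : ℝ) : center d 0 = 0 := by
  simp [center, Complex.ext_iff]

theorem center_smul (d : ℝ) (u : Cell) : center d u = d • center 1 u := by
  simp [center, Complex.ext_iff]

theorem region_eq_smul {d : ℝ} (hd : 0 < d) : region d 0 = (d • · : ℂ → ℂ) '' region 1 0 := by
  ext z
  simp only [region, Set.mem_ofPred_eq, Set.mem_image]
  constructor
  · intro h
    refine ⟨d⁻¹ • z, fun w => ?_, smul_inv_smul₀ hd.ne' z⟩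
    have := h w
    rw [center_smul d 0, center_smul d w] at this
    have e : ∀ w, d⁻¹ • z - center 1 w = d⁻¹ • (z - d • center 1 w) := fun w => by
      rw [smul_sub, inv_smul_smul₀ hd.ne']
    rw [e, e, norm_smul, norm_smul]
    gcongr
  · rintro ⟨y, hy, rfl⟩ w
    rw [center_smul d 0, center_smul d w, ← smul_sub, ← smul_sub, norm_smul, norm_smul]
    have := hy w
    gcongr

/-- The mean distance of a point of a cell from the centre, when neighbouring centres are at
distance `1`. -/
noncomputable def meanDist : ℝ := ⨍ z in region 1 0, ‖z‖

-- Dilation by `d` multiplies the area by `d²` and the integral of the norm by `d³`.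
open scoped Pointwise in
theorem setAverage_region {d : ℝ} (hd : 0 < d) :
    ⨍ z in region d 0, ‖z‖ = d * meanDist := by
  have h1 : region d 0 = d • region 1 0 := region_eq_smul hd
  have h2 := Measure.setIntegral_comp_smul_of_pos (volume : Measure ℂ) (fun z => ‖z‖) (region 1 0) hd
  simp only [norm_smul, Real.norm_eq_abs, abs_of_pos hd, Complex.finrank_real_complex,
    smul_eq_mul] at h2
  rw [integral_const_mul, ← h1] at h2
  have h3 : volume.real (region d 0) = d ^ 2 * volume.real (region 1 0) := by
    rw [h1, Measure.real, Measure.addHaar_smul, ENNReal.toReal_mul, Complex.finrank_real_complex,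
      abs_of_pos (by positivity), ENNReal.toReal_ofReal (by positivity), Measure.real]
  rw [meanDist, setAverage_eq, setAverage_eq, h3, smul_eq_mul, smul_eq_mul, mul_inv]
  rw [eq_comm, inv_mul_eq_iff_eq_mul₀ (by positivity)] at h2
  rw [h2]
  field_simp

theorem meanDist_pos : 0 < meanDist := by
  -- This ball avoids the origin, so the norm is positive on it, and it lies within distance `1 / 4`
  -- of the centre.
  have hsub : Metric.ball (1 / 8 : ℂ) (1 / 16) ⊆ Function.support (fun z : ℂ => ‖z‖) ∩ region 1 0 := by
    intro z hz
    rw [Metric.mem_ball, dist_eq_norm] at hz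
    have h8 : ‖(1 / 8 : ℂ)‖ = 1 / 8 := by norm_num
    have h1 := norm_sub_norm_le (1 / 8 : ℂ) z
    have h2 := norm_le_norm_add_norm_sub' z (1 / 8 : ℂ)
    rw [norm_sub_rev] at h1
    refine ⟨?_, closedBall_subset_region one_pos 0 ?_⟩
    · simp only [Function.mem_support]
      linarith
    · rw [center_zero, Metric.mem_closedBall, dist_zero_right]
      linarith
  have hbdd : region 1 0 ⊆ Metric.closedBall 0 1 := by
    intro z hz
    have := norm_sub_center_le one_pos hz
    rw [center_zero, sub_zero] at this
    rw [Metric.mem_closedBall, dist_zero_right]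
    linarith
  have hcomp : IsCompact (region 1 0) :=
    (isCompact_closedBall (0 : ℂ) 1).of_isClosed_subset (isClosed_region 1 0) hbdd
  have hball : 0 < volume (Metric.ball (1 / 8 : ℂ) (1 / 16)) :=
    Metric.measure_ball_pos _ _ (by norm_num)
  rw [meanDist, setAverage_eq, smul_eq_mul]
  refine mul_pos (inv_pos.2 ?_) ?_
  · exact ENNReal.toReal_pos
      (hball.trans_le (measure_mono (hsub.trans Set.inter_subset_right))).ne' hcomp.measure_ne_top
  · rw [setIntegral_pos_iff_support_of_nonneg_ae (ae_of_all _ fun z => norm_nonneg z)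
      (continuous_norm.continuousOn.integrableOn_compact hcomp)]
    exact hball.trans_le (measure_mono hsub)

end Mesh

namespace MeshFamily

open Mesh

variable (N : MeshFamily)

/-! ### Elementary facts on the tiers -/

theorem k_pos : 0 < N.k := by linarith [N.two_le_k]

theorem P₀_pos {l : ℕ} (hl : 1 ≤ l) : 0 < N.P₀ l := by
  obtain ⟨p, hp, h⟩ := N.P₀_bdd
  exact hp.trans_le (h l hl)

theorem d_pos {l : ℕ} (hl : 1 ≤ l) : 0 < N.d l := by
  have := N.d₁_pos
  have : (0 : ℝ) < l := by exact_mod_cast hl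
  unfold d; positivity

theorem M_pos {l : ℕ} (hl : 1 ≤ l) : 0 < N.M l := by
  have := N.M₁_pos
  have : (0 : ℝ) < l := by exact_mod_cast hl
  unfold M; positivity

theorem W_pos {l : ℕ} (hl : 1 ≤ l) : 0 < N.W l := by
  have := N.W₁_pos
  have : (0 : ℝ) < l := by exact_mod_cast hl
  unfold W; positivity

theorem W_eq (l : ℕ) : N.W l = (l : ℝ) ^ N.ψ * N.W 1 := by
  simp [W, mul_comm]

theorem M_eq (l : ℕ) : N.M l = (l : ℝ) ^ N.υ * N.M 1 := by
  simp [M, mul_comm]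

theorem C_mul_P {l : ℕ} (hl : 1 ≤ l) : N.C l * N.P l = N.P₀ l * N.d l ^ N.α l := by
  have := N.C_pos l hl
  unfold P; field_simp

theorem C_mul_P_pos {l : ℕ} (hl : 1 ≤ l) : 0 < N.C l * N.P l := by
  rw [N.C_mul_P hl]
  exact mul_pos (N.P₀_pos hl) (Real.rpow_pos_of_pos (N.d_pos hl) _)

/-- The transmit power is calibrated so that the range is exactly `d l` without gain; thresholds and
antenna constants cancel. -/
theorem range_eq {l : ℕ} (hl : 1 ≤ l) {g : ℝ} (hg : 0 ≤ g) :
    N.range l g = N.d l * g ^ (1 / N.α l) := by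
  have hd := N.d_pos hl
  have hP := N.P₀_pos hl
  have hα := N.α_pos l hl
  rw [range, N.C_mul_P hl, show N.P₀ l * N.d l ^ N.α l * g / N.P₀ l = N.d l ^ N.α l * g by
    field_simp, Real.mul_rpow (by positivity) hg, ← Real.rpow_mul hd.le,
    mul_one_div_cancel hα.ne', Real.rpow_one]

theorem D_pos (l : ℕ) : 0 < N.D l := by
  unfold D; positivity

theorem D_le {l m : ℕ} (hl : 1 ≤ l) (hm : l ≤ m) : N.D m ≤ N.D l := by
  have : (0 : ℝ) < l := by exact_mod_cast hl
  have : (l : ℝ) ≤ m := by exact_mod_cast hm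
  have := N.k_pos
  unfold D
  gcongr

theorem D_two_lt_D_one : N.D 2 < N.D 1 := by
  have := N.k_pos
  unfold D
  apply Real.rpow_lt_rpow <;> first | positivity | norm_num

theorem one_le_D (l : ℕ) : 1 ≤ N.D l :=
  Real.one_le_rpow (by simp) (by linarith [N.k_pos])

theorem d_succ {l : ℕ} (hl : 1 ≤ l) : N.d (l + 1) = N.d l * N.D l := by
  have : (0 : ℝ) < l := by exact_mod_cast hl
  unfold d D
  rw [mul_assoc, ← Real.mul_rpow (by positivity) (by positivity)]
  congr 2
  push_cast
  field_simp

theorem upHops_eq {l : ℕ} (hl : 1 ≤ l) {g : ℝ} (hg : 0 ≤ g) :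
    N.upHops l g = 2 * meanDist * N.D l / g ^ (1 / N.α l) := by
  have hd := N.d_pos hl
  rw [upHops, setAverage_region (N.d_pos (by omega)), N.range_eq hl hg, N.d_succ hl]
  field_simp

/-! ### The number of nodes of a tier -/

variable {N} {n l : ℕ}

theorem card_le (hl : 1 ≤ l) (hL : l ≤ N.L n) : ((N.V n l).card : ℝ) ≤ n / (l : ℝ) ^ N.k := by
  rw [N.V_card n l hl hL]
  exact Nat.floor_le (by positivity)

theorem lt_card_add_one (hl : 1 ≤ l) (hL : l ≤ N.L n) :
    n / (l : ℝ) ^ N.k < ((N.V n l).card : ℝ) + 1 := by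
  rw [N.V_card n l hl hL]
  exact Nat.lt_floor_add_one _

theorem V_nonempty (hl : 1 ≤ l) (hL : l ≤ N.L n) : (N.V n l).Nonempty :=
  ⟨0, (N.V_hex n l hl hL).zero_mem⟩

theorem one_le_card (hl : 1 ≤ l) (hL : l ≤ N.L n) : (1 : ℝ) ≤ (N.V n l).card := by
  exact_mod_cast (V_nonempty hl hL).card_pos

/-- Since `n_l ≥ 1`, rounding down loses at most a factor 2: `n / l ^ k < n_l + 1 ≤ 2 n_l`. -/
theorem div_card_le (hl : 1 ≤ l) (hL : l ≤ N.L n) :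
    (n : ℝ) / (N.V n l).card ≤ 2 * (l : ℝ) ^ N.k := by
  have h1 := one_le_card hl hL
  have h2 := lt_card_add_one hl hL
  have h0 : (0 : ℝ) < l := by exact_mod_cast hl
  have h3 : 0 < (l : ℝ) ^ N.k := by positivity
  rw [div_lt_iff₀ h3] at h2
  rw [div_le_iff₀ (by linarith)]
  nlinarith

theorem card_tier_one (hL : 1 ≤ N.L n) : (N.V n 1).card = n := by
  rw [N.V_card n 1 le_rfl hL]; simp

/-! ### Routing probabilities -/

theorem served_subset (n l : ℕ) : N.served n l ⊆ hopCounts (N.V n l) := Finset.filter_subset _ _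

theorem one_le_of_mem_served {x : ℕ} (h : x ∈ N.served n l) : (1 : ℝ) ≤ x := by
  exact_mod_cast pos_of_mem_hopCounts (served_subset n l h)

theorem le_D_of_mem_served (hl : l ≠ N.L n) {x : ℕ} (h : x ∈ N.served n l) : (x : ℝ) ≤ N.D l := by
  have := (Finset.mem_filter.1 h).2
  tauto

theorem ξ_nonneg (n l : ℕ) : 0 ≤ N.ξ n l := Finset.sum_nonneg fun _ _ => hopProb_nonneg _ _

theorem ξ_le_one (n l : ℕ) : N.ξ n l ≤ 1 := sum_hopProb_le_one (served_subset n l)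

theorem Q_nonneg (n l : ℕ) : 0 ≤ N.Q n l :=
  Finset.prod_nonneg fun i _ => by linarith [N.ξ_le_one n i]

theorem Q_le_one (n l : ℕ) : N.Q n l ≤ 1 :=
  Finset.prod_le_one (fun i _ => by linarith [N.ξ_le_one n i])
    fun i _ => by linarith [N.ξ_nonneg n i]

theorem Q_one (n : ℕ) : N.Q n 1 = 1 := by simp [Q]

theorem Q_succ (hl : 1 ≤ l) : N.Q n (l + 1) = N.Q n l * (1 - N.ξ n l) := by
  rw [Q, Finset.prod_Ico_succ_top hl, Q]

theorem Q_le_exp (n l : ℕ) : N.Q n l ≤ Real.exp (-∑ i ∈ Finset.Ico 1 l, N.ξ n i) := by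
  rw [← Finset.sum_neg_distrib, Real.exp_sum]
  refine Finset.prod_le_prod (fun i _ => by linarith [N.ξ_le_one n i]) fun i _ => ?_
  linarith [Real.add_one_le_exp (-N.ξ n i)]

/-- A disc of at most `D 1` hops contains a bounded number of cells, so only a share `O(1 / n_l)` of
the flows is finished below the top tier. -/
theorem ξ_le (hl : 1 ≤ l) (hL : l < N.L n) :
    N.ξ n l ≤ (2 * ⌊N.D 1⌋₊ + 1) ^ 2 / (((N.V n l).card : ℝ) - 1) := by
  refine sum_hopProb_le (V_nonempty hl hL.le) fun i _ => ?_
  have h := card_filter_hopDist_le (N.V n l) i ⌊N.D 1⌋₊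
  have h2 : (N.V n l).filter (fun j => hopDist i j ∈ N.served n l) ⊆
      (N.V n l).filter fun j => hopDist i j ≤ ⌊N.D 1⌋₊ := by
    intro j hj
    obtain ⟨h1, h2⟩ := Finset.mem_filter.1 hj
    exact Finset.mem_filter.2 ⟨h1, Nat.le_floor
      ((le_D_of_mem_served hL.ne h2).trans (N.D_le le_rfl hl))⟩
  exact_mod_cast (Finset.card_le_card h2).trans h

/-- Every node has a neighbour, and one hop is always permitted because `D l ≥ 1`. -/
theorem le_ξ (hl : 1 ≤ l) (hL : l ≤ N.L n) (hc : 2 ≤ (N.V n l).card) :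
    (l : ℝ) ^ N.k / n ≤ N.ξ n l := by
  have hc' : (2 : ℝ) ≤ (N.V n l).card := by exact_mod_cast hc
  have h0 : (0 : ℝ) < l := by exact_mod_cast hl
  have h3 : 0 < (l : ℝ) ^ N.k := by positivity
  have h1 : 1 / (((N.V n l).card : ℝ) - 1) ≤ N.ξ n l := by
    refine le_sum_hopProb (V_nonempty hl hL) fun i hi => ?_
    obtain ⟨v, hv, hiv⟩ := (N.V_hex n l hl hL).exists_neighbour hc hi
    have hne : i ≠ v := by
      rintro rfl
      rw [hopDist_self] at hiv
      omega
    have : 0 < ((N.V n l).filter (fun j => hopDist i j ∈ N.served n l)).card := by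
      refine Finset.card_pos.2 ⟨v, Finset.mem_filter.2 ⟨hv, Finset.mem_filter.2 ⟨?_, Or.inr ?_⟩⟩⟩
      · exact Finset.mem_image.2 ⟨(i, v), Finset.mem_offDiag.2 ⟨hi, hv, hne⟩, rfl⟩
      · rw [hiv, Nat.cast_one]
        exact N.one_le_D l
    exact_mod_cast this
  refine le_trans ?_ h1
  have h4 := card_le hl hL
  have h5 : (0 : ℝ) < n / (l : ℝ) ^ N.k := by linarith
  rw [← inv_div, ← one_div]
  apply one_div_le_one_div_of_le <;> linarith

/-! ### The load -/

/-- The mean number of cells that a flow that reaches tier `l` crosses there, when finished. -/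
noncomputable def meanCells (N : MeshFamily) (n l : ℕ) : ℝ := ∑ x ∈ N.served n l, hopProb (N.V n l) x * x

/-- The mean number of tier-`l` hops of a flow, without range extension. -/
noncomputable def hops (N : MeshFamily) (n l : ℕ) : ℝ :=
  (if l < N.L n then N.Q n (l + 1) * (2 * meanDist * N.D l) else 0) + N.Q n l * N.meanCells n l

theorem load_eq (hl : 1 ≤ l) {g : ℝ} (hg : 0 < g) :
    N.load n l g = n / (N.V n l).card * N.hops n l / g ^ (1 / N.α l) := by
  have hd := N.d_pos hl
  have hs : N.sameHops n l g = N.meanCells n l / g ^ (1 / N.α l) := by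
    rw [sameHops, meanCells, Finset.sum_div]
    refine Finset.sum_congr rfl fun x _ => ?_
    rw [N.range_eq hl hg.le]
    field_simp
  rw [load, hops, N.upHops_eq hl hg.le, hs]
  split_ifs <;> ring

theorem meanCells_nonneg (n l : ℕ) : 0 ≤ N.meanCells n l :=
  Finset.sum_nonneg fun _ _ => mul_nonneg (hopProb_nonneg _ _) (Nat.cast_nonneg _)

theorem meanCells_le {B : ℝ} (hB : ∀ x ∈ N.served n l, (x : ℝ) ≤ B) :
    N.meanCells n l ≤ N.ξ n l * B := by
  rw [meanCells, ξ, Finset.sum_mul]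
  exact Finset.sum_le_sum fun x hx => mul_le_mul_of_nonneg_left (hB x hx) (hopProb_nonneg _ _)

theorem ξ_le_meanCells (n l : ℕ) : N.ξ n l ≤ N.meanCells n l :=
  Finset.sum_le_sum fun _ hx =>
    le_mul_of_one_le_right (hopProb_nonneg _ _) (one_le_of_mem_served hx)

theorem hops_nonneg (n l : ℕ) : 0 ≤ N.hops n l := by
  have h1 := N.Q_nonneg n (l + 1)
  have h2 := N.Q_nonneg n l
  have h3 := N.meanCells_nonneg n l
  have h4 := meanDist_pos
  have h5 := N.D_pos l
  unfold hops
  split_ifs <;> positivity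

theorem le_hops_one (hL : 1 < N.L n) :
    (1 - N.ξ n 1) * (2 * meanDist * N.D 1) + N.ξ n 1 ≤ N.hops n 1 := by
  rw [hops, if_pos hL, Q_succ le_rfl, Q_one, one_mul, one_mul]
  linarith [N.ξ_le_meanCells n 1]

/-- A flow is either passed on, at a cost of `2 * meanDist * D 1`, or finished over at least one
cell; a weighted mean is at least the smaller value. -/
theorem min_le_hops_one (hL : 1 < N.L n) : min (2 * meanDist * N.D 1) 1 ≤ N.hops n 1 := by
  have h1 := N.ξ_nonneg n 1
  have h2 := N.ξ_le_one n 1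
  have h3 := min_le_left (2 * meanDist * N.D 1) 1
  have h4 := min_le_right (2 * meanDist * N.D 1) 1
  refine le_trans ?_ (le_hops_one hL)
  nlinarith [mul_le_mul_of_nonneg_left h3 (sub_nonneg.2 h2), mul_le_mul_of_nonneg_left h4 h1]

/-! ### Growth of the number of tiers and uniform bounds on the hop number -/

/-- Eventually, the number of tiers is at least a constant multiple of the `k`-th root of `n`. -/
theorem exists_le_L (N : MeshFamily) :
    ∃ c : ℝ, 0 < c ∧ ∀ᶠ n : ℕ in atTop, c * (n : ℝ) ^ (1 / N.k) ≤ N.L n := by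
  obtain ⟨c, hc, h⟩ := N.L_theta.2.exists_pos
  refine ⟨c⁻¹, inv_pos.2 hc, ?_⟩
  filter_upwards [h.bound] with n hn
  rw [Real.norm_of_nonneg (by positivity), Real.norm_of_nonneg (by positivity)] at hn
  rwa [inv_mul_le_iff₀ hc]

theorem tendsto_root (N : MeshFamily) :
    Tendsto (fun n : ℕ => (n : ℝ) ^ (1 / N.k)) atTop atTop :=
  (tendsto_rpow_atTop (one_div_pos.2 N.k_pos)).comp tendsto_natCast_atTop_atTop

theorem eventually_lt_L (N : MeshFamily) (m : ℕ) : ∀ᶠ n in atTop, m < N.L n := by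
  obtain ⟨c, hc, h⟩ := N.exists_le_L
  filter_upwards [h, (N.tendsto_root.const_mul_atTop hc).eventually_gt_atTop (m : ℝ)] with n h1 h2
  exact_mod_cast h2.trans_le h1

theorem rpow_root (N : MeshFamily) (n : ℕ) : ((n : ℝ) ^ (1 / N.k)) ^ N.k = n := by
  rw [← Real.rpow_mul (Nat.cast_nonneg n), one_div_mul_cancel N.k_pos.ne', Real.rpow_one]

theorem exists_meanCells_le (N : MeshFamily) :
    ∃ B : ℝ, 0 < B ∧ ∀ᶠ n in atTop, ∀ l, 1 ≤ l → l ≤ N.L n → N.meanCells n l ≤ B := by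
  obtain ⟨c, hc, h⟩ := N.exists_le_L
  refine ⟨max (N.D 1) (2 / c ^ N.k), lt_max_of_lt_left (N.D_pos 1), ?_⟩
  filter_upwards [h, eventually_gt_atTop 0] with n hn hn0 l hl hL
  -- Below the top tier the routing policy caps hop counts by `D 1`. At the top tier `L ≥ c * n ^ (1
  -- / k)` leaves at most `1 / c ^ k` nodes, hence at most twice as many hops.
  have key : ∀ x ∈ N.served n l, (x : ℝ) ≤ max (N.D 1) (2 / c ^ N.k) := by
    intro x hx
    by_cases hlL : l = N.L n
    · refine le_max_of_le_right ?_
      have h1 : (x : ℝ) ≤ 2 * (N.V n l).card := by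
        exact_mod_cast (N.V_hex n l hl hL).le_of_mem_hopCounts (served_subset n l hx)
      have h2 := card_le hl hL
      have h3 : c ^ N.k * n ≤ (l : ℝ) ^ N.k := by
        have := N.k_pos
        rw [← hlL] at hn
        have h4 : (c * (n : ℝ) ^ (1 / N.k)) ^ N.k ≤ (l : ℝ) ^ N.k := by gcongr
        rwa [Real.mul_rpow hc.le (by positivity), N.rpow_root n] at h4
      have hn' : (0 : ℝ) < n := by exact_mod_cast hn0
      have h4 : n / (l : ℝ) ^ N.k ≤ n / (c ^ N.k * n) := by gcongr
      have h5 : n / (c ^ N.k * n) = 1 / c ^ N.k := by field_simp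
      rw [show 2 / c ^ N.k = 2 * (1 / c ^ N.k) by ring]
      linarith
    · exact le_max_of_le_left ((le_D_of_mem_served hlL hx).trans (N.D_le le_rfl hl))
  refine (meanCells_le key).trans (mul_le_of_le_one_left ?_ (ξ_le_one n l))
  exact le_max_of_le_left (N.D_pos 1).le

/-- The factor `Q` is kept because its smallness at high tiers decides the comparison with tier 1.
-/
theorem exists_hops_le (N : MeshFamily) :
    ∃ K : ℝ, 0 < K ∧ ∀ᶠ n in atTop, ∀ l, 1 ≤ l → l ≤ N.L n → N.hops n l ≤ N.Q n l * K := by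
  obtain ⟨B, hB, h⟩ := N.exists_meanCells_le
  have hm := meanDist_pos
  have hD := N.D_pos 1
  refine ⟨2 * meanDist * N.D 1 + B, by positivity, ?_⟩
  filter_upwards [h] with n hn l hl hL
  have h1 := N.Q_nonneg n l
  have h2 : (if l < N.L n then N.Q n (l + 1) * (2 * meanDist * N.D l) else 0) ≤
      N.Q n l * (2 * meanDist * N.D 1) := by
    split_ifs
    · have h3 : N.Q n (l + 1) ≤ N.Q n l := by
        rw [Q_succ hl]
        exact mul_le_of_le_one_right h1 (by linarith [N.ξ_nonneg n l])
      have := N.D_le le_rfl hl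
      have := N.D_pos l
      gcongr
    · positivity
  have h3 := mul_le_mul_of_nonneg_left (hn l hl hL) h1
  rw [hops]
  linarith

theorem exists_hops_le_const (N : MeshFamily) :
    ∃ K : ℝ, 0 < K ∧ ∀ᶠ n in atTop, ∀ l, 1 ≤ l → l ≤ N.L n → N.hops n l ≤ K := by
  obtain ⟨K, hK, h⟩ := N.exists_hops_le
  refine ⟨K, hK, ?_⟩
  filter_upwards [h] with n hn l hl hL
  exact (hn l hl hL).trans (mul_le_of_le_one_left hK.le (Q_le_one n l))

/-! ### End-to-end rates -/

/-- Positivity of `R` excludes the quotient `0 / 0`, which is 0; a tier without load then has rate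
`∞`. -/
theorem le_endRate {R Z c : ℝ} (hR : 0 < R) (hc : 0 ≤ c) (h : c * ((1 + (N.Δc : ℝ)) * Z) ≤ R) :
    ENNReal.ofReal c ≤ N.endRate R Z := by
  rw [endRate, ENNReal.le_div_iff_mul_le (Or.inr (ENNReal.ofReal_pos.2 hR).ne')
    (Or.inr ENNReal.ofReal_ne_top), ← ENNReal.ofReal_mul hc]
  exact ENNReal.ofReal_le_ofReal h

theorem endRate_eq {R Z : ℝ} (hZ : 0 < Z) :
    N.endRate R Z = ENNReal.ofReal (R / ((1 + (N.Δc : ℝ)) * Z)) := by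
  rw [endRate, ENNReal.ofReal_div_of_pos (by positivity)]

/-- A tier whose link rate grows at least as fast as its load has at least the same end-to-end
rate. -/
theorem endRate_le_endRate {R Z R' Z' t : ℝ} (ht : 0 < t) (hR : 0 < R) (hZ : 0 < Z)
    (hR' : t * R ≤ R') (hZ' : Z' ≤ t * Z) : N.endRate R Z ≤ N.endRate R' Z' := by
  rw [endRate_eq hZ]
  refine le_endRate ((mul_pos ht hR).trans_le hR') (by positivity) (le_trans ?_ hR')
  calc R / ((1 + (N.Δc : ℝ)) * Z) * ((1 + (N.Δc : ℝ)) * Z')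
      ≤ R / ((1 + (N.Δc : ℝ)) * Z) * ((1 + (N.Δc : ℝ)) * (t * Z)) := by gcongr
    _ = t * R := by field_simp

/-- The scaling criterion: tier `l` has at least a constant rate if its link rate, multiplied by
the range extension, is of order `l ^ k`. -/
theorem allTiersOmegaOne_endRate {R g : ℕ → ℕ → ℝ} {c : ℝ} (hc : 0 < c)
    (hg : ∀ n l, 1 ≤ l → 0 < g n l)
    (hR : ∀ n l, 1 ≤ l → l ≤ N.L n → c * (l : ℝ) ^ N.k ≤ R n l * g n l ^ (1 / N.α l)) :
    N.AllTiersOmegaOne fun n l => N.endRate (R n l) (N.load n l (g n l)) := by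
  obtain ⟨K, hK, h⟩ := N.exists_hops_le_const
  refine ⟨c / ((1 + N.Δc) * (2 * K)), by positivity, ?_⟩
  filter_upwards [h] with n hn l hl hL
  have h0 : (0 : ℝ) < l := by exact_mod_cast hl
  have hg' : 0 < g n l ^ (1 / N.α l) := Real.rpow_pos_of_pos (hg n l hl) _
  have hR' := hR n l hl hL
  have hpos : 0 < R n l := pos_of_mul_pos_left (lt_of_lt_of_le (by positivity) hR') hg'.le
  refine le_endRate hpos (by positivity) ?_
  rw [load_eq hl (hg n l hl)]
  have h1 := div_card_le hl hL
  have h2 := hn l hl hL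
  have h3 := N.hops_nonneg n l
  calc c / ((1 + N.Δc) * (2 * K)) *
        ((1 + N.Δc) * (n / (N.V n l).card * N.hops n l / g n l ^ (1 / N.α l)))
      ≤ c / ((1 + N.Δc) * (2 * K)) *
        ((1 + N.Δc) * (2 * (l : ℝ) ^ N.k * K / g n l ^ (1 / N.α l))) := by gcongr
    _ = c * (l : ℝ) ^ N.k / g n l ^ (1 / N.α l) := by field_simp
    _ ≤ R n l := by rwa [div_le_iff₀ hg']

theorem load_one_eq (hL : 1 ≤ N.L n) (hn : 0 < n) {g : ℝ} (hg : 0 < g) :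
    N.load n 1 g = N.hops n 1 / g ^ (1 / N.α 1) := by
  have : (0 : ℝ) < n := by exact_mod_cast hn
  rw [load_eq le_rfl hg, card_tier_one hL, div_self this.ne', one_mul]

/-- The throughput is of order one if all tiers have at least a constant rate and the first tier
has bounded link rates. -/
theorem isThetaOne_throughput {R : ℕ → ℕ → ℝ} {g : ℕ → ℝ} {B : ℝ} (hg : 0 < g 1)
    (hΩ : N.AllTiersOmegaOne fun n l => N.endRate (R n l) (N.load n l (g l)))
    (hB : ∀ n, 1 ≤ N.L n → R n 1 ≤ B) :
    IsThetaOne (N.throughput fun n l => N.endRate (R n l) (N.load n l (g l))) := by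
  obtain ⟨c, hc, h⟩ := hΩ
  set m := min (2 * meanDist * N.D 1) 1
  have hm : 0 < m := by
    have := meanDist_pos
    have := N.D_pos 1
    positivity
  have hg' : 0 < g 1 ^ (1 / N.α 1) := Real.rpow_pos_of_pos hg _
  -- No sign of `B` is known; the numerator must be nonnegative for the quotient to decrease when
  -- the load grows.
  refine ⟨c, max B 0 / ((1 + N.Δc) * (m / g 1 ^ (1 / N.α 1))), hc, ?_⟩
  filter_upwards [h, N.eventually_lt_L 1, eventually_gt_atTop 0] with n hn hL hn0
  constructor
  · exact Finset.le_inf fun l hl => hn l (Finset.mem_Icc.1 hl).1 (Finset.mem_Icc.1 hl).2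
  · refine (Finset.inf_le (Finset.mem_Icc.2 ⟨le_rfl, hL.le⟩)).trans ?_
    have h1 := min_le_hops_one hL
    dsimp only
    rw [load_one_eq hL.le hn0 hg, endRate_eq (div_pos (hm.trans_le h1) hg')]
    have h2 : R n 1 ≤ max B 0 := (hB n hL.le).trans (le_max_left _ _)
    gcongr

end MeshFamily

namespace Mesh

/-! ### Interference -/

theorem summable_cell {a : ℝ} (ha : 2 < a) : Summable fun w : Cell => ‖w‖ ^ (-a) := by
  have h := (finTwoArrowEquiv ℤ).symm.summable_iff.2 (EisensteinSeries.summable_one_div_norm_rpow ha)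
  refine h.congr fun w => ?_
  simp [finTwoArrowEquiv, EisensteinSeries.norm_eq_max_natAbs, Prod.norm_def, Int.norm_eq_abs]

theorem norm_sub_le_hopDist (u v : Cell) : ‖u - v‖ ≤ hopDist u v := by
  have e : ∀ t : ℤ, |(t : ℝ)| = ((t.natAbs : ℕ) : ℝ) := fun t => by
    rw [Nat.cast_natAbs]; push_cast; rfl
  rw [Prod.norm_def]
  simp only [Prod.fst_sub, Prod.snd_sub, Int.norm_eq_abs, e]
  refine max_le ?_ ?_ <;> exact_mod_cast (by unfold hopDist; omega)

theorem norm_sub_le_of_hopDist_le_one {d : ℝ} (hd : 0 < d) {u v : Cell} (h : hopDist u v ≤ 1)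
    {x y : ℂ} (hx : x ∈ region d u) (hy : y ∈ region d v) : ‖x - y‖ ≤ 3 * d := by
  have h1 := norm_sub_center_le hd hx
  have h2 := norm_sub_center_le hd hy
  have h3 := norm_center_sub_le hd.le h
  have h4 : x - y = (x - center d u) + (center d u - center d v) - (y - center d v) := by ring
  rw [h4]
  refine (norm_sub_le _ _).trans ?_
  have := norm_add_le (x - center d u) (center d u - center d v)
  linarith

/-- The centres are at least `0.86 h d` apart and the two points deviate from them by at most `1.2
d` in total; `0.86 h - 1.2 ≥ h / 4` holds from `h = 2` on. -/
theorem le_norm_sub_of_two_le_hopDist {d : ℝ} (hd : 0 < d) {u v : Cell} (h : 2 ≤ hopDist u v)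
    {x y : ℂ} (hx : x ∈ region d u) (hy : y ∈ region d v) : d / 4 * ‖u - v‖ ≤ ‖x - y‖ := by
  have h1 := norm_sub_center_le hd hx
  have h2 := norm_sub_center_le hd hy
  have h3 := le_norm_center_sub d u v
  have h4 : center d u - center d v = (x - y) - (x - center d u) + (y - center d v) := by ring
  rw [h4] at h3
  have h5 := norm_add_le ((x - y) - (x - center d u)) (y - center d v)
  have h6 := norm_sub_le (x - y) (x - center d u)
  have h7 := norm_sub_le_hopDist u v
  have h8 : (2 : ℝ) ≤ hopDist u v := by exact_mod_cast h
  nlinarith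

/-- The interference from cells at least two hops away from the receiver is bounded, uniformly in
the network. -/
theorem interference_le {a b α d : ℝ} (ha : 2 < a) (haα : a ≤ α) (hαb : α ≤ b) (hd : 0 < d)
    {v : Cell} {y : ℂ} (hy : y ∈ region d v) {z : Cell → ℂ} (hz : ∀ w, z w ∈ region d w)
    (F : Finset Cell) (hF : ∀ w ∈ F, 2 ≤ hopDist w v) :
    ∑ w ∈ F, ‖z w - y‖ ^ (-α) ≤ d ^ (-α) * (4 ^ b * ∑' w : Cell, ‖w‖ ^ (-a)) := by
  have h4 : (4 : ℝ) ^ α ≤ 4 ^ b := Real.rpow_le_rpow_of_exponent_le (by norm_num) hαb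
  have key : ∀ w ∈ F, ‖z w - y‖ ^ (-α) ≤ d ^ (-α) * 4 ^ b * ‖w - v‖ ^ (-a) := by
    intro w hw
    have hne : w - v ≠ 0 := by
      intro h
      have := hF w hw
      rw [sub_eq_zero.1 h, hopDist_self] at this
      omega
    -- A base of at least 1 allows the exponent `-α` to be replaced by the larger `-a`, which does
    -- not depend on the tier.
    have h1 : 1 ≤ ‖w - v‖ := by
      rw [Prod.norm_def]
      by_contra! h
      obtain ⟨h1, h2⟩ := max_lt_iff.1 h
      rw [Int.norm_eq_abs] at h1 h2
      have h1' : |(w - v).1| < 1 := by exact_mod_cast h1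
      have h2' : |(w - v).2| < 1 := by exact_mod_cast h2
      exact hne (Prod.ext (Int.abs_lt_one_iff.1 h1') (Int.abs_lt_one_iff.1 h2'))
    have h0 : 0 < ‖w - v‖ := by linarith
    calc ‖z w - y‖ ^ (-α) ≤ (d / 4 * ‖w - v‖) ^ (-α) :=
          Real.rpow_le_rpow_of_nonpos (by positivity)
            (le_norm_sub_of_two_le_hopDist hd (hF w hw) (hz w) hy) (by linarith)
      _ = d ^ (-α) * 4 ^ α * ‖w - v‖ ^ (-α) := by
          rw [Real.mul_rpow (by positivity) h0.le, Real.div_rpow hd.le (by norm_num),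
            Real.rpow_neg (by norm_num : (0 : ℝ) ≤ 4), div_inv_eq_mul]
      _ ≤ d ^ (-α) * 4 ^ b * ‖w - v‖ ^ (-a) := by
          have := Real.rpow_le_rpow_of_exponent_le h1 (neg_le_neg haα)
          gcongr
  refine (Finset.sum_le_sum key).trans ?_
  rw [← Finset.mul_sum, mul_assoc]
  gcongr
  have hs := summable_cell ha
  have hs' : Summable fun w : Cell => ‖w - v‖ ^ (-a) := (Equiv.subRight v).summable_iff.2 hs
  rw [← (Equiv.subRight v).tsum_eq fun w : Cell => ‖w‖ ^ (-a)]
  exact hs'.sum_le_tsum F fun w _ => by positivity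

end Mesh

namespace MeshFamily

open Mesh

variable {N : MeshFamily} {n l : ℕ}

/-! ### Spatial multiplexing -/

theorem sinrSM_nonneg (hl : 1 ≤ l) (u : Cell) (x y : ℂ) (z : Cell → ℂ) :
    0 ≤ N.sinrSM n l u x y z := by
  have := N.C_mul_P_pos hl
  have := N.N₀_pos
  unfold sinrSM
  have : 0 ≤ ∑ w ∈ (N.V n l).filter (fun w => w ≠ u ∧ N.slot l w = N.slot l u),
      N.C l * N.P l * ‖z w - y‖ ^ (-N.α l) := Finset.sum_nonneg fun w _ => by positivity
  positivity

/-- As `C * P = P₀ * d ^ α`, the distance `d` cancels from both signal and interference, and the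
SINR is at least `P₀ σ / (N₀ + P₀ T)` with `σ`, `T` independent of the tier. This increases with
`P₀`, so `P₀` may be replaced by its lower bound `p`. -/
theorem le_sinrSM {a b p : ℝ} (ha : 2 < a) (hα : ∀ l, 1 ≤ l → a ≤ N.α l ∧ N.α l ≤ b) (hp : 0 < p)
    (hP : ∀ l, 1 ≤ l → p ≤ N.P₀ l) (hl : 1 ≤ l) {u v : Cell} {x y : ℂ} {z : Cell → ℂ}
    (huv : hopDist u v ≤ 1) (hx : x ∈ region (N.d l) u) (hy : y ∈ region (N.d l) v) (hxy : x ≠ y)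
    (hz : ∀ w, z w ∈ region (N.d l) w) :
    p * 3 ^ (-b) / (N.N₀ + p * (4 ^ b * ∑' w : Cell, ‖w‖ ^ (-a))) ≤ N.sinrSM n l u x y z := by
  have hd := N.d_pos hl
  have hN := N.N₀_pos
  have hP0 := N.P₀_pos hl
  obtain ⟨h1, h2⟩ := hα l hl
  set T := 4 ^ b * ∑' w : Cell, ‖w‖ ^ (-a)
  have hT : 0 ≤ T := mul_nonneg (by positivity) (tsum_nonneg fun w => by positivity)
  have hsig : N.P₀ l * 3 ^ (-b) ≤ N.C l * N.P l * ‖x - y‖ ^ (-N.α l) := by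
    have e1 : (3 * N.d l) ^ (-N.α l) ≤ ‖x - y‖ ^ (-N.α l) :=
      Real.rpow_le_rpow_of_nonpos (norm_pos_iff.2 (sub_ne_zero.2 hxy))
        (norm_sub_le_of_hopDist_le_one hd huv hx hy) (by linarith)
    have e2 : (3 : ℝ) ^ (-b) ≤ 3 ^ (-N.α l) :=
      Real.rpow_le_rpow_of_exponent_le (by norm_num) (neg_le_neg h2)
    calc N.P₀ l * 3 ^ (-b) ≤ N.P₀ l * 3 ^ (-N.α l) := by gcongr
      _ = N.P₀ l * N.d l ^ N.α l * (3 * N.d l) ^ (-N.α l) := by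
          rw [Real.mul_rpow (by norm_num) hd.le, Real.rpow_neg hd.le]
          field_simp
      _ ≤ _ := by
          rw [N.C_mul_P hl]
          gcongr
  have hint : ∑ w ∈ (N.V n l).filter (fun w => w ≠ u ∧ N.slot l w = N.slot l u),
      N.C l * N.P l * ‖z w - y‖ ^ (-N.α l) ≤ N.P₀ l * T := by
    rw [← Finset.mul_sum, N.C_mul_P hl]
    have hF := interference_le ha h1 h2 hd hy hz
      ((N.V n l).filter (fun w => w ≠ u ∧ N.slot l w = N.slot l u)) fun w hw => by
        obtain ⟨-, hwu, hs⟩ := Finset.mem_filter.1 hw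
        -- A cell sharing the slot of `u` is at least three hops from `u`, hence at least two from
        -- the receiving cell `v`.
        have h3 : ¬ hopDist w u ≤ 2 := fun h => N.slot_ne l w u hwu h hs
        have h4 := hopDist_triangle w v u
        rw [hopDist_comm v u] at h4
        omega
    calc _ ≤ N.P₀ l * N.d l ^ N.α l * (N.d l ^ (-N.α l) * T) := by gcongr
      _ = N.P₀ l * T := by
          rw [Real.rpow_neg hd.le]
          field_simp
  have hint0 : 0 ≤ ∑ w ∈ (N.V n l).filter (fun w => w ≠ u ∧ N.slot l w = N.slot l u),
      N.C l * N.P l * ‖z w - y‖ ^ (-N.α l) := by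
    have := N.C_mul_P_pos hl
    exact Finset.sum_nonneg fun w _ => by positivity
  have hsig0 : 0 ≤ N.C l * N.P l * ‖x - y‖ ^ (-N.α l) := le_trans (by positivity) hsig
  calc p * 3 ^ (-b) / (N.N₀ + p * T) ≤ N.P₀ l * 3 ^ (-b) / (N.N₀ + N.P₀ l * T) := by
        rw [div_le_div_iff₀ (by positivity) (by positivity)]
        have := hP l hl
        have h3 : (0 : ℝ) < 3 ^ (-b) := by positivity
        nlinarith [mul_le_mul_of_nonneg_left this (mul_pos h3 hN).le]
    _ ≤ N.sinrSM n l u x y z := by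
        unfold sinrSM
        gcongr

theorem M_le_succ (hl : 1 ≤ l) : N.M l ≤ N.M (l + 1) := by
  have := N.M₁_pos
  have := N.one_le_υ
  unfold M
  gcongr
  simp

theorem M_le_of_mem {Nt Nr : ℝ} (hl : 1 ≤ l)
    (h : (Nt = N.M l ∧ Nr = N.M l) ∨ (Nt = N.M l ∧ Nr = N.M (l + 1)) ∨
      (Nt = N.M (l + 1) ∧ Nr = N.M l)) : N.M l ≤ min Nt Nr := by
  have := N.M_le_succ hl
  rcases h with ⟨rfl, rfl⟩ | ⟨rfl, rfl⟩ | ⟨rfl, rfl⟩ <;> simp [this]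

/-- An explicit link inside the central cell: it makes the set nonempty, as the infimum requires,
and bounds the rate of tier 1 from above. -/
theorem linkRateSM_mem (hl : 1 ≤ l) (hL : l ≤ N.L n) :
    N.M l * (N.W l * Real.logb 2 (1 + N.sinrSM n l 0 0 (N.d l / 4 : ℝ) (center (N.d l)))) ∈
      N.linkRatesSM n l := by
  have hd := N.d_pos hl
  have h0 := (N.V_hex n l hl hL).zero_mem
  have hc : ∀ w, center (N.d l) w ∈ region (N.d l) w := fun w =>
    closedBall_subset_region hd w (Metric.mem_closedBall_self (by positivity))
  refine ⟨N.M l, N.M l, 0, 0, 0, (N.d l / 4 : ℝ), center (N.d l), Or.inl ⟨rfl, rfl⟩, h0, h0,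
    by simp [hopDist_self], ?_, ?_, ?_, hc, by rw [min_self]⟩
  · simpa only [center_zero] using hc 0
  · refine closedBall_subset_region hd 0 ?_
    rw [center_zero, Metric.mem_closedBall, dist_zero_right, Complex.norm_real,
      Real.norm_of_nonneg (by positivity)]
  · rw [ne_comm, Complex.ofReal_ne_zero]
    positivity

theorem le_linkRateSM {s : ℝ} (hs : 0 ≤ s) (hl : 1 ≤ l) (hL : l ≤ N.L n)
    (h : ∀ (u v : Cell) (x y : ℂ) (z : Cell → ℂ), hopDist u v ≤ 1 → x ∈ region (N.d l) u →
      y ∈ region (N.d l) v → x ≠ y → (∀ w, z w ∈ region (N.d l) w) → s ≤ N.sinrSM n l u x y z) :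
    N.M l * (N.W l * Real.logb 2 (1 + s)) ≤ N.linkRateSM n l := by
  refine le_csInf ⟨_, linkRateSM_mem hl hL⟩ ?_
  rintro r ⟨Nt, Nr, u, v, x, y, z, hN, -, -, huv, hx, hy, hxy, hz, rfl⟩
  have hM := N.M_pos hl
  have hW := N.W_pos hl
  have h1 := M_le_of_mem hl hN
  have hmin : 0 ≤ min Nt Nr := hM.le.trans h1
  have h2 := h u v x y z huv hx hy hxy hz
  have h3 : 0 ≤ Real.logb 2 (1 + s) := Real.logb_nonneg (by norm_num) (by linarith)
  have h4 : Real.logb 2 (1 + s) ≤ Real.logb 2 (1 + N.sinrSM n l u x y z) :=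
    Real.logb_le_logb_of_le (by norm_num) (by linarith) (by linarith)
  gcongr

/-- Dropping the interference from the SINR of the explicit link leaves a bound free of `n`. -/
theorem exists_linkRateSM_one_le (N : MeshFamily) :
    ∃ B : ℝ, ∀ n, 1 ≤ N.L n → N.linkRateSM n 1 ≤ B := by
  refine ⟨N.M 1 * (N.W 1 * Real.logb 2 (1 + N.C 1 * N.P 1 * ‖(0 : ℂ) - (N.d 1 / 4 : ℝ)‖ ^ (-N.α 1)
    / N.N₀)), fun n hL => ?_⟩
  have hM := N.M_pos le_rfl
  have hW := N.W_pos le_rfl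
  have hbdd : BddBelow (N.linkRatesSM n 1) := by
    refine ⟨0, ?_⟩
    rintro r ⟨Nt, Nr, u, v, x, y, z, hN, -, -, -, -, -, -, -, rfl⟩
    have h1 := M_le_of_mem le_rfl hN
    exact mul_nonneg (hM.le.trans h1) (mul_nonneg hW.le
      (Real.logb_nonneg (by norm_num) (by linarith [N.sinrSM_nonneg (n := n) le_rfl u x y z])))
  refine (csInf_le hbdd (linkRateSM_mem le_rfl hL)).trans ?_
  have h0 := N.C_mul_P_pos le_rfl
  have hN := N.N₀_pos
  have hs := N.sinrSM_nonneg (n := n) le_rfl 0 0 (N.d 1 / 4 : ℝ) (center (N.d 1))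
  have h1 : N.sinrSM n 1 0 0 (N.d 1 / 4 : ℝ) (center (N.d 1)) ≤
      N.C 1 * N.P 1 * ‖(0 : ℂ) - (N.d 1 / 4 : ℝ)‖ ^ (-N.α 1) / N.N₀ := by
    unfold sinrSM
    gcongr
    exact le_add_of_nonneg_right (Finset.sum_nonneg fun w _ => by positivity)
  have h2 := Real.logb_le_logb_of_le (b := 2) (by norm_num) (by linarith)
    (add_le_add_right h1 1)
  gcongr

theorem scalability_SM (N : MeshFamily)
    (hα : ∃ a b : ℝ, 2 < a ∧ ∀ l, 1 ≤ l → a ≤ N.α l ∧ N.α l ≤ b) (hk : N.k ≤ N.ψ + N.υ) :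
    N.AllTiersOmegaOne N.rateSM ∧ IsThetaOne (N.throughput N.rateSM) := by
  obtain ⟨a, b, ha, hα⟩ := hα
  obtain ⟨p, hp, hP⟩ := N.P₀_bdd
  obtain ⟨B, hB⟩ := N.exists_linkRateSM_one_le
  set s := p * 3 ^ (-b) / (N.N₀ + p * (4 ^ b * ∑' w : Cell, ‖w‖ ^ (-a)))
  have hs : 0 < s := by
    have := N.N₀_pos
    have : 0 ≤ ∑' w : Cell, ‖w‖ ^ (-a) := tsum_nonneg fun w => by positivity
    positivity
  have hlog : 0 < Real.logb 2 (1 + s) := Real.logb_pos (by norm_num) (by linarith)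
  have hM := N.M₁_pos
  have hW := N.W₁_pos
  have hΩ : N.AllTiersOmegaOne N.rateSM := by
    refine N.allTiersOmegaOne_endRate (R := N.linkRateSM) (g := fun _ _ => 1)
      (c := N.M₁ * N.W₁ * Real.logb 2 (1 + s)) (by positivity) (fun _ _ _ => one_pos)
      fun n l hl hL => ?_
    have h1 : (1 : ℝ) ≤ l := by exact_mod_cast hl
    rw [Real.one_rpow, mul_one]
    refine le_trans ?_ (le_linkRateSM hs.le hl hL fun u v x y z huv hx hy hxy hz =>
      le_sinrSM ha hα hp hP hl huv hx hy hxy hz)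
    have h2 := Real.rpow_le_rpow_of_exponent_le h1 hk
    calc N.M₁ * N.W₁ * Real.logb 2 (1 + s) * (l : ℝ) ^ N.k
        ≤ N.M₁ * N.W₁ * Real.logb 2 (1 + s) * (l : ℝ) ^ (N.ψ + N.υ) := by gcongr
      _ = N.M l * (N.W l * Real.logb 2 (1 + s)) := by
          rw [Real.rpow_add (by linarith), M, W]
          ring
  exact ⟨hΩ, N.isThetaOne_throughput (R := N.linkRateSM) (g := fun _ => 1) one_pos hΩ hB⟩

end MeshFamily

namespace MeshFamily

open Mesh

variable {N : MeshFamily} {n l : ℕ}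

/-! ### Beamforming -/

theorem sinrBF_eq (hl : 1 ≤ l) : N.sinrBF l = N.P₀ l * N.M l ^ 2 / (N.N₀ + N.I₀) := by
  have hd := N.d_pos hl
  rw [sinrBF, show N.C l * N.M l ^ 2 * N.P l * N.d l ^ (-N.α l) =
    N.C l * N.P l * N.M l ^ 2 * N.d l ^ (-N.α l) by ring, N.C_mul_P hl, Real.rpow_neg hd.le]
  congr 1
  field_simp

theorem M_one_le (hl : 1 ≤ l) : N.M 1 ≤ N.M l := by
  have h1 : (1 : ℝ) ≤ l := by exact_mod_cast hl
  rw [N.M_eq l]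
  exact le_mul_of_one_le_left (N.M_pos le_rfl).le (Real.one_le_rpow h1 (by linarith [N.one_le_υ]))

theorem le_sinrBF {p : ℝ} (hl : 1 ≤ l) (hP : p ≤ N.P₀ l) :
    p * N.M 1 ^ 2 / (N.N₀ + N.I₀) ≤ N.sinrBF l := by
  have h1 := N.M_pos le_rfl
  have h2 := N.M_one_le hl
  have h3 := N.N₀_pos
  have h4 := N.I₀_nonneg
  have h5 := N.P₀_pos hl
  rw [sinrBF_eq hl]
  gcongr

theorem gain_rpow (hl : 1 ≤ l) (α : ℝ) :
    (N.M l ^ 2) ^ (1 / α) = (l : ℝ) ^ (2 * N.υ / α) * (N.M 1 ^ 2) ^ (1 / α) := by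
  have h0 : (0 : ℝ) < l := by exact_mod_cast hl
  rw [N.M_eq l, mul_pow, Real.mul_rpow (by positivity) (by positivity), ← Real.rpow_natCast,
    ← Real.rpow_mul h0.le, ← Real.rpow_mul h0.le]
  congr 2
  push_cast
  ring

/-! ### Comparison of the higher tiers with the first one -/

theorem eventually_ξ_one_le {δ : ℝ} (hδ : 0 < δ) : ∀ᶠ n in atTop, N.ξ n 1 ≤ δ := by
  have h : Tendsto (fun n : ℕ => (2 * ⌊N.D 1⌋₊ + 1 : ℝ) ^ 2 / ((n : ℝ) - 1)) atTop (𝓝 0) :=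
    Tendsto.div_atTop tendsto_const_nhds
      (tendsto_atTop_add_const_right _ (-1) tendsto_natCast_atTop_atTop)
  filter_upwards [h.eventually_le_const hδ, N.eventually_lt_L 1] with n h1 h2
  have h3 := ξ_le le_rfl h2
  rw [card_tier_one h2.le] at h3
  exact h3.trans h1

/-- Only few flows reach the tiers with a bounded number of nodes. -/
theorem eventually_Q_le (N : MeshFamily) {X δ : ℝ} (hX : 3 ≤ X) (hδ : 0 < δ) :
    ∀ᶠ n : ℕ in atTop, ∀ l, 1 ≤ l → l ≤ N.L n → n < X * (l : ℝ) ^ N.k → N.Q n l ≤ δ := by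
  have hk := N.k_pos
  -- With `ε ^ k = 1 / X`, the assumption `n < X * l ^ k` says that `l > ε * n ^ (1 / k)`.
  set ε : ℝ := X ^ (-(1 / N.k))
  have hε : 0 < ε := by positivity
  have hεk : ε ^ N.k = X⁻¹ := by
    rw [← Real.rpow_mul (by positivity), neg_mul, one_div_mul_cancel hk.ne', Real.rpow_neg_one]
  set r : ℕ → ℝ := fun n => (n : ℝ) ^ (1 / N.k)
  have hr : Tendsto r atTop atTop := N.tendsto_root
  have hexp : Tendsto (fun n => Real.exp (-(ε / 4 * r n * (ε / 4) ^ N.k))) atTop (𝓝 0) :=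
    Real.tendsto_exp_neg_atTop_nhds_zero.comp
      ((hr.const_mul_atTop (by positivity)).atTop_mul_const (by positivity))
  filter_upwards [hexp.eventually_le_const hδ, hr.eventually_ge_atTop (4 / ε),
    eventually_gt_atTop 0] with n h1 h2 hn0 l hl hL hX'
  have hn : (0 : ℝ) < n := by exact_mod_cast hn0
  have hrk : r n ^ N.k = n := N.rpow_root n
  have hr0 : 0 < r n := by positivity
  have hl0 : (0 : ℝ) < l := by exact_mod_cast hl
  have hεl : ε * r n < l := by
    by_contra! h
    have : (l : ℝ) ^ N.k ≤ (ε * r n) ^ N.k := by gcongr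
    rw [Real.mul_rpow hε.le hr0.le, hrk, hεk, inv_mul_eq_div, le_div_iff₀ (by linarith)] at this
    linarith
  refine (Q_le_exp n l).trans (le_trans (Real.exp_le_exp.2 (neg_le_neg ?_)) h1)
  -- Each tier of the block `[m, 2m)` below `l` has `ξ ≥ (ε / 4) ^ k`, and there are at least `ε / 4
  -- * r n` of them, so the sum of the `ξ` is unbounded in `n`. The condition `r n ≥ 4 / ε` gives `m
  -- ≥ 1`.
  set m := ⌊ε * r n / 2⌋₊
  have hm1 : (m : ℝ) ≤ ε * r n / 2 := Nat.floor_le (by positivity)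
  have hm2 : ε * r n / 2 < m + 1 := Nat.lt_floor_add_one _
  rw [div_le_iff₀ hε] at h2
  have hm3 : ε / 4 * r n ≤ m := by linarith
  have hm0 : 1 ≤ m := by
    have : (1 : ℝ) ≤ m := by linarith
    exact_mod_cast this
  have hsub : Finset.Ico m (2 * m) ⊆ Finset.Ico 1 l := by
    refine Finset.Ico_subset_Ico hm0 ?_
    have : ((2 * m : ℕ) : ℝ) ≤ l := by push_cast; linarith
    exact_mod_cast this
  have hξ : ∀ i ∈ Finset.Ico m (2 * m), (ε / 4) ^ N.k ≤ N.ξ n i := by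
    intro i hi
    obtain ⟨hi1, hi2⟩ := Finset.mem_Ico.1 hi
    obtain ⟨hi3, hi4⟩ := Finset.mem_Ico.1 (hsub hi)
    have hi0 : (0 : ℝ) < i := by exact_mod_cast hi3
    have hiL : i ≤ N.L n := by omega
    have hir : (i : ℝ) ≤ ε * r n := by
      have : (i : ℝ) ≤ 2 * m := by exact_mod_cast hi2.le
      linarith
    have hik : (i : ℝ) ^ N.k * X ≤ n := by
      have : (i : ℝ) ^ N.k ≤ (ε * r n) ^ N.k := by gcongr
      rwa [Real.mul_rpow hε.le hr0.le, hrk, hεk, inv_mul_eq_div, le_div_iff₀ (by linarith)] at this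
    -- Here `X ≥ 3` is used: `n / i ^ k ≥ 3` leaves at least two nodes after rounding.
    have hcard : 2 ≤ (N.V n i).card := by
      have h3 := lt_card_add_one hi3 hiL
      have h4 : X ≤ n / (i : ℝ) ^ N.k := by
        rw [le_div_iff₀ (by positivity)]; linarith
      have : (2 : ℝ) < (N.V n i).card := by linarith
      exact_mod_cast this.le
    refine le_trans ?_ (le_ξ hi3 hiL hcard)
    rw [le_div_iff₀ hn, ← hrk, ← Real.mul_rpow (by positivity) hr0.le]
    have : (m : ℝ) ≤ i := by exact_mod_cast hi1
    gcongr
    linarith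
  calc ε / 4 * r n * (ε / 4) ^ N.k ≤ m * (ε / 4) ^ N.k := by gcongr
    _ = ∑ i ∈ Finset.Ico m (2 * m), (ε / 4) ^ N.k := by
        rw [Finset.sum_const, Nat.card_Ico, nsmul_eq_mul]
        congr 2
        omega
    _ ≤ ∑ i ∈ Finset.Ico m (2 * m), N.ξ n i := Finset.sum_le_sum hξ
    _ ≤ _ := Finset.sum_le_sum_of_subset_of_nonneg hsub fun i _ _ => N.ξ_nonneg n i

/-- The main term keeps `D l` instead of `D 1`: the comparison with tier 1 rests on the gap between
`D 2` and `D 1`. -/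
theorem hops_le (hl : 1 ≤ l) (hL : l < N.L n) :
    N.hops n l ≤ 2 * meanDist * N.D l + N.ξ n l * N.D 1 := by
  have hm := meanDist_pos
  have hD := N.D_pos l
  have h1 : N.meanCells n l ≤ N.ξ n l * N.D 1 :=
    meanCells_le fun x hx => (le_D_of_mem_served hL.ne hx).trans (N.D_le le_rfl hl)
  rw [hops, if_pos hL]
  exact add_le_add (mul_le_of_le_one_left (by positivity) (Q_le_one _ _))
    ((mul_le_of_le_one_left (meanCells_nonneg _ _) (Q_le_one _ _)).trans h1)

/-- Eventually, the load of a tier without range extension is at most `l ^ k` times the load of the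
first tier. -/
theorem eventually_div_card_mul_hops_le (N : MeshFamily) :
    ∀ᶠ n : ℕ in atTop, ∀ l, 1 ≤ l → l ≤ N.L n →
      n / (N.V n l).card * N.hops n l ≤ (l : ℝ) ^ N.k * N.hops n 1 := by
  have hκ := meanDist_pos
  have hk := N.k_pos
  have hD1 := N.D_pos 1
  have hD2 := N.D_pos 2
  set A := 2 * meanDist * N.D 1
  set A₂ := 2 * meanDist * N.D 2
  have hA₂ : 0 < A₂ := by positivity
  have hA : A₂ < A := mul_lt_mul_of_pos_left N.D_two_lt_D_one (by positivity)
  -- The midpoint separates the limiting hop number `A` of tier 1 from the bound `A₂` that tiers `l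
  -- ≥ 2` approach when they have many nodes.
  set θ := (A₂ + A) / 2
  have hθ : 0 < θ := by simp only [θ]; linarith
  set J : ℝ := (2 * ⌊N.D 1⌋₊ + 1) ^ 2
  obtain ⟨c, hc, hcL⟩ := N.exists_le_L
  obtain ⟨K, hK, hhops⟩ := N.exists_hops_le
  have hlim : Tendsto (fun X : ℝ => (1 + 1 / (X - 1)) * (A₂ + J / (X - 2) * N.D 1)) atTop
      (𝓝 ((1 + 0) * (A₂ + 0 * N.D 1))) := by
    have e1 : Tendsto (fun X : ℝ => 1 / (X - 1)) atTop (𝓝 0) := Tendsto.div_atTop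
      tendsto_const_nhds (tendsto_atTop_add_const_right _ (-1) tendsto_id)
    have e2 : Tendsto (fun X : ℝ => J / (X - 2)) atTop (𝓝 0) := Tendsto.div_atTop
      tendsto_const_nhds (tendsto_atTop_add_const_right _ (-2) tendsto_id)
    exact (e1.const_add 1).mul ((e2.mul_const _).const_add _)
  obtain ⟨X₀, hX₀⟩ := eventually_atTop.1
    (hlim.eventually_le_const (show (1 + 0) * (A₂ + 0 * N.D 1) < θ by simp only [θ]; linarith))
  -- `X₀` makes the error terms fit below `θ`, 3 is required by `eventually_Q_le`, and the last
  -- entry keeps the top tier out of the case of many nodes.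
  set X₁ := max (max X₀ 3) (1 / c ^ N.k + 1)
  -- Once `ξ` of tier 1 is at most this number, `(1 - ξ) * A ≥ θ`.
  have hδ : 0 < 1 - θ / A := by
    rw [sub_pos, div_lt_one (hA₂.trans hA)]; simp only [θ]; linarith
  filter_upwards [hcL, hhops, N.eventually_lt_L 1, eventually_gt_atTop 0,
    N.eventually_ξ_one_le hδ,
    N.eventually_Q_le (X := X₁) (δ := θ / (2 * K)) (le_max_of_le_left (le_max_right _ _))
      (by positivity)] with n hcL hhops hL1 hn0 hξ1 hQ l hl hL
  have hn : (0 : ℝ) < n := by exact_mod_cast hn0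
  have hl0 : (0 : ℝ) < l := by exact_mod_cast hl
  have hlk : 0 < (l : ℝ) ^ N.k := by positivity
  have hθ1 : θ ≤ N.hops n 1 := by
    refine le_trans ?_ (le_hops_one hL1)
    have h1 : θ / A * A ≤ (1 - N.ξ n 1) * A := by
      have : 0 < A := hA₂.trans hA
      gcongr
      linarith
    rw [div_mul_cancel₀ _ (hA₂.trans hA).ne'] at h1
    linarith [N.ξ_nonneg n 1]
  have hcard := one_le_card hl hL
  rcases eq_or_lt_of_le hl with rfl | hl2
  · rw [card_tier_one hL, div_self hn.ne', Nat.cast_one, Real.one_rpow]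
  -- With few nodes, `Q l ≤ θ / (2 * K)` cancels the 2 from rounding and the `K` from the hop bound.
  -- With many nodes, both corrections tend to 0 as `Y` grows.
  rcases lt_or_ge (n : ℝ) (X₁ * (l : ℝ) ^ N.k) with hX | hX
  · have h1 := hQ l hl hL hX
    have h2 := hhops l hl hL
    have h3 := div_card_le hl hL
    have h4 := N.hops_nonneg n l
    calc n / (N.V n l).card * N.hops n l ≤ 2 * (l : ℝ) ^ N.k * (θ / (2 * K) * K) := by
          refine mul_le_mul h3 (h2.trans ?_) h4 (by positivity)
          gcongr
      _ = (l : ℝ) ^ N.k * θ := by field_simp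
      _ ≤ _ := by gcongr
  · set Y := n / (l : ℝ) ^ N.k
    have hY : X₁ ≤ Y := (le_div_iff₀ hlk).2 hX
    have hY0 : X₀ ≤ Y := ((le_max_left _ _).trans (le_max_left _ _)).trans hY
    have hY3 : 3 ≤ Y := ((le_max_right _ _).trans (le_max_left _ _)).trans hY
    have hYc : 1 / c ^ N.k < Y := by
      have : 1 / c ^ N.k + 1 ≤ Y := (le_max_right _ _).trans hY
      linarith
    have hlL : l < N.L n := by
      refine lt_of_le_of_ne hL fun h => ?_
      have h4 : (c * (n : ℝ) ^ (1 / N.k)) ^ N.k ≤ (l : ℝ) ^ N.k := by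
        rw [← h] at hcL
        gcongr
      rw [Real.mul_rpow hc.le (by positivity), N.rpow_root n] at h4
      have hck : 0 < c ^ N.k := by positivity
      rw [div_lt_div_iff₀ hck hlk] at hYc
      linarith
    have hlt : Y < (N.V n l).card + 1 := lt_card_add_one hl hL
    have h1 : n / ((N.V n l).card : ℝ) ≤ (l : ℝ) ^ N.k * (1 + 1 / (Y - 1)) := by
      have e1 : (n : ℝ) = (l : ℝ) ^ N.k * Y := by simp only [Y]; field_simp
      have e2 : 1 + 1 / (Y - 1) = Y / (Y - 1) := by
        have : Y - 1 ≠ 0 := by linarith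
        field_simp
        ring
      rw [e2, ← mul_div_assoc, ← e1]
      have : 0 < Y - 1 := by linarith
      gcongr
      linarith
    have h2 : N.hops n l ≤ A₂ + J / (Y - 2) * N.D 1 := by
      refine (hops_le hl hlL).trans (add_le_add ?_ ?_)
      · exact mul_le_mul_of_nonneg_left (N.D_le one_le_two hl2) (by positivity)
      · have h3 : J / ((N.V n l).card - 1) ≤ J / (Y - 2) := by
          have hJ : 0 ≤ J := by positivity
          exact div_le_div_of_nonneg_left hJ (by linarith) (by linarith)
        exact mul_le_mul_of_nonneg_right ((ξ_le hl hlL).trans h3) hD1.le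
    have h3 := hX₀ Y hY0
    have h4 : 0 < Y - 1 := by linarith
    calc n / (N.V n l).card * N.hops n l
        ≤ (l : ℝ) ^ N.k * (1 + 1 / (Y - 1)) * (A₂ + J / (Y - 2) * N.D 1) :=
          mul_le_mul h1 h2 (N.hops_nonneg n l) (by positivity)
      _ = (l : ℝ) ^ N.k * ((1 + 1 / (Y - 1)) * (A₂ + J / (Y - 2) * N.D 1)) := by ring
      _ ≤ _ := by
          gcongr
          exact h3.trans hθ1

/-! ### The beamforming statements -/

theorem scalability_BF (N : MeshFamily) {α : ℝ} (hα : ∀ l, 1 ≤ l → N.α l = α)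
    (hk : N.k ≤ N.ψ + 2 * N.υ / α) :
    N.AllTiersOmegaOne N.rateBF ∧ IsThetaOne (N.throughput N.rateBF) := by
  obtain ⟨p, hp, hP⟩ := N.P₀_bdd
  have hM := N.M_pos le_rfl
  have hW := N.W_pos le_rfl
  have hN := N.N₀_pos
  have hI := N.I₀_nonneg
  set s := p * N.M 1 ^ 2 / (N.N₀ + N.I₀)
  have hs : 0 < s := by positivity
  have hlog : 0 < Real.logb 2 (1 + s) := Real.logb_pos (by norm_num) (by linarith)
  have hΩ : N.AllTiersOmegaOne N.rateBF := by
    refine N.allTiersOmegaOne_endRate (R := fun _ => N.linkRateBF) (g := fun _ l => N.M l ^ 2)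
      (c := N.W 1 * Real.logb 2 (1 + s) * (N.M 1 ^ 2) ^ (1 / α)) (by positivity)
      (fun _ l hl => pow_pos (N.M_pos hl) 2) fun n l hl hL => ?_
    have h1 : (1 : ℝ) ≤ l := by exact_mod_cast hl
    have h0 : (0 : ℝ) < l := by linarith
    rw [hα l hl, gain_rpow hl, linkRateBF, N.W_eq l]
    have h2 := Real.rpow_le_rpow_of_exponent_le h1 hk
    rw [Real.rpow_add h0] at h2
    have h3 : Real.logb 2 (1 + s) ≤ Real.logb 2 (1 + N.sinrBF l) :=
      Real.logb_le_logb_of_le (by norm_num) (by linarith)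
        (by linarith [le_sinrBF hl (hP l hl)])
    have h4 : 0 ≤ Real.logb 2 (1 + N.sinrBF l) := hlog.le.trans h3
    calc N.W 1 * Real.logb 2 (1 + s) * (N.M 1 ^ 2) ^ (1 / α) * (l : ℝ) ^ N.k
        ≤ N.W 1 * Real.logb 2 (1 + N.sinrBF l) * (N.M 1 ^ 2) ^ (1 / α) *
          ((l : ℝ) ^ N.ψ * (l : ℝ) ^ (2 * N.υ / α)) := by gcongr
      _ = _ := by ring
  exact ⟨hΩ, N.isThetaOne_throughput (R := fun _ => N.linkRateBF) (g := fun l => N.M l ^ 2)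
    (B := N.linkRateBF 1) (by positivity) hΩ fun _ _ => le_rfl⟩

/-- Relative to tier 1, the link rate of tier `l` grows at least by `l ^ ψ`, as the SINR does not
decrease when thresholds are at least `P₀ 1`. The load grows at most by `l ^ k / l ^ (2υ / α)`,
which is at most `l ^ ψ`. -/
theorem throughput_BF_eq (N : MeshFamily) {α : ℝ} (hα : ∀ l, 1 ≤ l → N.α l = α)
    (hk : N.k ≤ N.ψ + 2 * N.υ / α) (hP : ∀ l, 1 ≤ l → N.P₀ 1 ≤ N.P₀ l) :
    ∀ᶠ n in atTop, N.throughput N.rateBF n = N.rateBF n 1 := by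
  have hM := N.M_pos le_rfl
  have hW := N.W_pos le_rfl
  have hN := N.N₀_pos
  have hI := N.I₀_nonneg
  have hP1 := N.P₀_pos le_rfl
  have hs : 0 < N.sinrBF 1 := by rw [sinrBF_eq le_rfl]; positivity
  have hlog : 0 < Real.logb 2 (1 + N.sinrBF 1) := Real.logb_pos (by norm_num) (by linarith)
  have hG : 0 < (N.M 1 ^ 2) ^ (1 / α) := by positivity
  filter_upwards [N.eventually_div_card_mul_hops_le, N.eventually_lt_L 1, eventually_gt_atTop 0]
    with n hn hL1 hn0
  refine le_antisymm (Finset.inf_le (Finset.mem_Icc.2 ⟨le_rfl, hL1.le⟩))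
    (Finset.le_inf fun l hl => ?_)
  obtain ⟨hl, hL⟩ := Finset.mem_Icc.1 hl
  have h1 : (1 : ℝ) ≤ l := by exact_mod_cast hl
  have h0 : (0 : ℝ) < l := by linarith
  have hhops : 0 < N.hops n 1 := by
    have h2 := meanDist_pos
    have h3 := N.D_pos 1
    exact lt_of_lt_of_le (by positivity) (min_le_hops_one hL1)
  have hload1 : N.load n 1 (N.M 1 ^ 2) = N.hops n 1 / (N.M 1 ^ 2) ^ (1 / α) := by
    rw [load_one_eq hL1.le hn0 (by positivity), hα 1 le_rfl]
  refine endRate_le_endRate (t := (l : ℝ) ^ N.ψ) (by positivity) (mul_pos hW hlog)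
    (by rw [hload1]; positivity) ?_ ?_
  · have h2 : N.sinrBF 1 ≤ N.sinrBF l := by
      rw [sinrBF_eq le_rfl]
      exact le_sinrBF hl (hP l hl)
    have h3 : Real.logb 2 (1 + N.sinrBF 1) ≤ Real.logb 2 (1 + N.sinrBF l) :=
      Real.logb_le_logb_of_le (by norm_num) (by linarith) (by linarith)
    rw [linkRateBF, linkRateBF, N.W_eq l, ← mul_assoc]
    gcongr
  · rw [hload1, load_eq hl (pow_pos (N.M_pos hl) 2), hα l hl, gain_rpow hl]
    have h2 := Real.rpow_le_rpow_of_exponent_le h1 hk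
    rw [Real.rpow_add h0] at h2
    rw [div_le_iff₀ (by positivity)]
    calc n / (N.V n l).card * N.hops n l ≤ (l : ℝ) ^ N.k * N.hops n 1 := hn l hl hL
      _ ≤ (l : ℝ) ^ N.ψ * (l : ℝ) ^ (2 * N.υ / α) * N.hops n 1 := by gcongr
      _ = _ := by field_simp

end MeshFamily

theorem mainTheorem4 (N : MeshFamily) :
    ((∃ a b : ℝ, 2 < a ∧ ∀ l, 1 ≤ l → a ≤ N.α l ∧ N.α l ≤ b) → N.k ≤ N.ψ + N.υ →
      N.AllTiersOmegaOne N.rateSM ∧ IsThetaOne (N.throughput N.rateSM)) ∧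
    (∀ α : ℝ, (∀ l, 1 ≤ l → N.α l = α) → N.k ≤ N.ψ + 2 * N.υ / α →
      N.AllTiersOmegaOne N.rateBF ∧ IsThetaOne (N.throughput N.rateBF) ∧
      ((∀ l, 1 ≤ l → N.P₀ 1 ≤ N.P₀ l) →
        ∀ᶠ n in atTop, N.throughput N.rateBF n = N.rateBF n 1)) :=
  ⟨N.scalability_SM, fun _ hα hk =>
    ⟨(N.scalability_BF hα hk).1, (N.scalability_BF hα hk).2, N.throughput_BF_eq hα hk⟩⟩
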